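/- Setting. Let $\Omega\subset\mathbb R^d$ be measurable with $0<|\Omega|<\infty$, and let $y\in L_2(\Omega)$. Let $(\varphi_k)_{k\in I}$ be a dictionary of bounded continuous functions on $\Omega$, and let $P_1\subseteq P_2\subseteq\cdots$ be finite subsets of $I$, with $p=|P_n|\to\infty$. For sample size $n$ write $\varphi(x)=(\varphi_k(x))_{k\in P_n}$, and let $$\beta^*\in\operatorname*{argmin}_{\beta\in\mathbb R^{P_n}}\int_\Omega (y(x)-\varphi(x)^T\beta)^2\,dx .$$ Let $x_1,x_2,\dots$ be (fixed or random) points of $\Omega$ whose empirical distributions converge weakly, almost surely, to the uniform distribution on $\Omega$. The responses are $y_i=y(x_i)+\epsilon_i$, $i\le n$. In the deterministic case $\epsilon_i=0$ for all $i$. In the stochastic case the $\epsilon_i$ are i.i.d., independent of the inputs, with mean $0$ and variance $\sigma^2>0$, and sub-Gaussian: $\mathbb P(|\epsilon_i|>t)\le \exp(1-t^2/K)$ for all $t\ge0$, where $K>0$. For each $n$ let $J_1,\dots,J_q\subseteq P_n$ (with $q=q_n$) be possibly overlapping groups with union $P_n$, and put $d_j=|J_j|$. The overlapping group lasso estimate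 is $\hat\beta=\sum_j \hat v_j$, where $(\hat v_j)_j$ is any minimizer of $$\frac1{2n}\sum_{i=1}^n\Bigl(y_i-\varphi(x_i)^T\sum_j v_j\Bigr)^2+\lambda_n\sum_j\sqrt{d_j}\,\|v_j\|_2$$ over vectors $v_j\in\mathbb R^{P_n}$ supported in $J_j$, and $\lambda_n>0$. Let $\bar c$ be the largest number of groups containing a single index, $\bar d=\max_j d_j$, and $s=\|\beta^*\|_0$; all of these may depend on $n$. Assume $s\ge1$ for all large $n$. With $C=\frac1n\sum_{i\le n}\varphi(x_i)\varphi(x_i)^T$, let $\phi_{\min}(m)$ and $\phi_{\max}(m)$ be the minimum and maximum of $\beta^TC\beta/\beta^T\beta$ over $\beta\neq0$ with $\|\beta\|_0\le m$. Assume that, for constants $0<\kappa_{\min}\le\kappa_{\max}<\infty$, almost surely $$\liminf_{n}\phi_{\min}\bigl(s\bar c\bar d\max\{\log n,\bar c\}\bigr)\ge\kappa_{\min},\qquad \limsup_n\phi_{\max}\bigl((s\bar c+n)\bar d\bigr)\le\kappa_{\max}.$$ Assume also $\lambda_n\asymp\sqrt{\log p/n}$, $\bar d^2=o(\log n)$ and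 $\sup_{x\in\Omega}|y(x)-\varphi(x)^T\beta^*|=O(\lambda_n)$. In the stochastic case assume further that $\lambda_n\ge A\sqrt{\log p/n}$ for all large $n$, where $A=A(K,\kappa_{\max})>0$ is a sufficiently large constant depending only on $K$ and $\kappa_{\max}$. Claim. In both the deterministic and the stochastic case, there is a constant $c>0$, independent of $n$, such that with probability tending to $1$ as $n\to\infty$, $$\int_\Omega (y(x)-\varphi(x)^T\hat\beta)^2\,dx\le c\,\frac{\bar c^2 s\bar d\log p}{n}.$$ -/

import Mathlib

open MeasureTheory ProbabilityTheory Filter Asymptotics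
open scoped Topology Matrix BigOperators

namespace OGL

/-! ### Sparse eigenvalues -/

/-- `φ_min(m)`: the minimum of the Rayleigh quotient `βᵀCβ / βᵀβ` over the nonzero vectors `β`
with at most `m` nonzero entries. -/
noncomputable def sparseMinEig {K : Type*} [Fintype K] (C : Matrix K K ℝ) (m : ℝ) : ℝ :=
  sInf {r | ∃ β : K → ℝ, β ≠ 0 ∧ (hammingNorm β : ℝ) ≤ m ∧ r = (β ⬝ᵥ (C *ᵥ β)) / (β ⬝ᵥ β)}

/-- `φ_max(m)`: the maximum of the Rayleigh quotient `βᵀCβ / βᵀβ` over the nonzero vectors `β`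
with at most `m` nonzero entries. -/
noncomputable def sparseMaxEig {K : Type*} [Fintype K] (C : Matrix K K ℝ) (m : ℝ) : ℝ :=
  sSup {r | ∃ β : K → ℝ, β ≠ 0 ∧ (hammingNorm β : ℝ) ≤ m ∧ r = (β ⬝ᵥ (C *ᵥ β)) / (β ⬝ᵥ β)}

/-- The matrix `(1/n) φᵀφ` of an `n`-row design matrix `φ`. -/
noncomputable def gram {K : Type*} {n : ℕ} (Φ : Matrix (Fin n) K ℝ) : Matrix K K ℝ :=
  (1 / (n : ℝ)) • (Φᵀ * Φ)

/-! ### Overlapping groups and the overlapping group lasso -/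

open Classical in
/-- `c̄`: the largest number of groups that a single coefficient belongs to. -/
noncomputable def maxMultiplicity {K : Type*} [Fintype K] {q : ℕ} (J : Fin q → Finset K) : ℕ :=
  Finset.univ.sup fun k : K => (Finset.univ.filter fun j : Fin q => k ∈ J j).card

/-- `d̄`: the size of the largest group. -/
def maxGroupSize {K : Type*} {q : ℕ} (J : Fin q → Finset K) : ℕ :=
  Finset.univ.sup fun j : Fin q => (J j).card

/-- Replicated coefficients: one coefficient `v j k` for every group `j` and every `k ∈ J j`
(stored with the value zero where `k ∉ J j`). -/
def IsReplicated {K : Type*} {q : ℕ} (J : Fin q → Finset K) (v : Fin q → K → ℝ) : Prop :=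
  ∀ j k, k ∉ J j → v j k = 0

/-- The penalised least-squares objective, as a function of the replicated coefficients. -/
noncomputable def objective {K : Type*} [Fintype K] {n q : ℕ} (Φ : Matrix (Fin n) K ℝ)
    (Y : Fin n → ℝ) (lam : ℝ) (J : Fin q → Finset K) (v : Fin q → K → ℝ) : ℝ :=
  1 / (2 * (n : ℝ)) * ∑ i, (Y i - ∑ k, (∑ j, v j k) * Φ i k) ^ 2
    + lam * ∑ j, √((J j).card : ℝ) * √(∑ k ∈ J j, (v j k) ^ 2)

/-- `b` is an overlapping group lasso estimate: the replicates of some minimiser of the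
objective, added up coefficient by coefficient. -/
def IsOverlappingGroupLasso {K : Type*} [Fintype K] {n q : ℕ} (Φ : Matrix (Fin n) K ℝ)
    (Y : Fin n → ℝ) (lam : ℝ) (J : Fin q → Finset K) (b : K → ℝ) : Prop :=
  ∃ v : Fin q → K → ℝ, IsReplicated J v ∧
    (∀ w : Fin q → K → ℝ, IsReplicated J w → objective Φ Y lam J v ≤ objective Φ Y lam J w) ∧
    ∀ k, b k = ∑ j, v j k

/-! ### The inputs and the noise -/

/-- The empirical distributions of the sequence `x` in `Ω` converge (weakly) to the uniform
distribution on `Ω`. -/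
def EquidistributedOn {E : Type*} [TopologicalSpace E] [MeasureSpace E]
    (Ω : Set E) (x : ℕ → E) : Prop :=
  (∀ i, x i ∈ Ω) ∧
    ∀ f : E → ℝ, ContinuousOn f Ω → (∃ M, ∀ t ∈ Ω, |f t| ≤ M) →
      Tendsto (fun n : ℕ => (1 / (n : ℝ)) * ∑ i ∈ Finset.range n, f (x i)) atTop
        (𝓝 (⨍ t in Ω, f t))

/-- Independent, identically distributed sub-Gaussian noise with tail parameter `K`, mean zero
and variance `σ²`, independent of the inputs. -/
structure IsSubGaussianNoise {W E : Type*} [MeasurableSpace W] [MeasurableSpace E]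
    (μ : Measure W) (x : ℕ → W → E) (ε : ℕ → W → ℝ) (σ K : ℝ) : Prop where
  measurable : ∀ i, Measurable (ε i)
  indep : iIndepFun ε μ
  identDistrib : ∀ i, IdentDistrib (ε i) (ε 0) μ μ
  indep_inputs : IndepFun (fun ω i => x i ω) (fun ω i => ε i ω) μ
  tail : ∀ i, ∀ t : ℝ, 0 ≤ t → μ.real {ω | t < |ε i ω|} ≤ Real.exp (1 - t ^ 2 / K)
  mean_zero : ∀ i, μ[ε i] = 0
  variance_eq : ∀ i, Var[ε i; μ] = σ ^ 2

/-! ### The experiment -/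

/-- The data of a sequence of computer experiments of growing size `n` on a region of `ℝ^d`. -/
structure Experiment (d : ℕ) (ι W : Type*) where
  /-- the input region -/
  Ω : Set (EuclideanSpace ℝ (Fin d))
  /-- the computer model -/
  y : EuclideanSpace ℝ (Fin d) → ℝ
  /-- the dictionary of all basis functions -/
  φ : ι → EuclideanSpace ℝ (Fin d) → ℝ
  /-- the basis functions that are included when `n` inputs are used -/
  P : ℕ → Finset ι
  /-- the number of groups -/
  q : ℕ → ℕ
  /-- the groups -/
  J : (n : ℕ) → Fin (q n) → Finset (P n)
  /-- the input locations -/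
  x : ℕ → W → EuclideanSpace ℝ (Fin d)
  /-- the noise on the responses -/
  ε : ℕ → W → ℝ
  /-- the best coefficients -/
  βstar : (n : ℕ) → P n → ℝ
  /-- the tuning parameters -/
  lam : ℕ → ℝ
  /-- the estimated coefficients -/
  βhat : (n : ℕ) → W → P n → ℝ

namespace Experiment

variable {d : ℕ} {ι W : Type*} (S : Experiment d ι W)

/-- The number `p` of basis functions. -/
def p (n : ℕ) : ℕ := (S.P n).card

/-- `s`: the number of nonzero best coefficients. -/
noncomputable def s (n : ℕ) : ℕ := hammingNorm (S.βstar n)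

/-- `c̄`. -/
noncomputable def cbar (n : ℕ) : ℕ := maxMultiplicity (S.J n)

/-- `d̄`. -/
def dbar (n : ℕ) : ℕ := maxGroupSize (S.J n)

/-- The linear predictor `φ(t)ᵀβ`. -/
def pred (n : ℕ) (β : S.P n → ℝ) (t : EuclideanSpace ℝ (Fin d)) : ℝ :=
  ∑ k : S.P n, S.φ k t * β k

/-- The oracle risk `∫_Ω (y(t) - φ(t)ᵀβ)² dt`. -/
noncomputable def oracleRisk (n : ℕ) (β : S.P n → ℝ) : ℝ :=
  ∫ t in S.Ω, (S.y t - S.pred n β t) ^ 2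

/-- The design matrix, with rows `φ(x_i)ᵀ`. -/
def design (n : ℕ) (ω : W) : Matrix (Fin n) (S.P n) ℝ :=
  Matrix.of fun i k => S.φ k (S.x i ω)

/-- The responses `y_i = y(x_i) + ε_i`, that is, `φ(x_i)ᵀβ* + B_i + ε_i` with the bias
`B_i = y(x_i) - φ(x_i)ᵀβ*`. -/
def response (n : ℕ) (ω : W) : Fin n → ℝ :=
  fun i => S.y (S.x i ω) + S.ε i ω

/-- `√(log p / n)`. -/
noncomputable def lamRate (n : ℕ) : ℝ := √(Real.log (S.p n) / n)

/-- `c̄² s d̄ log p / n`. -/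
noncomputable def riskRate (n : ℕ) : ℝ :=
  (S.cbar n : ℝ) ^ 2 * S.s n * S.dbar n * Real.log (S.p n) / n

/-- The assumptions that are common to the deterministic and the stochastic case. -/
structure Assumptions [MeasurableSpace W] (μ : Measure W) (κmin κmax : ℝ) : Prop where
  measurableSet_region : MeasurableSet S.Ω
  volume_ne_zero : volume S.Ω ≠ 0
  volume_ne_top : volume S.Ω ≠ ⊤
  /-- `y` is square integrable on the region, so that the oracle risk makes sense. -/
  memLp_model : MemLp S.y 2 (volume.restrict S.Ω)
  continuousOn_basis : ∀ k, ContinuousOn (S.φ k) S.Ω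
  bounded_basis : ∀ k, ∃ M, ∀ t ∈ S.Ω, |S.φ k t| ≤ M
  /-- Larger experiments include more basis functions. -/
  basis_mono : Monotone S.P
  tendsto_p : Tendsto S.p atTop atTop
  groups_cover : ∀ n k, ∃ j, k ∈ S.J n j
  measurable_inputs : ∀ i, Measurable (S.x i)
  inputs_uniform : ∀ᵐ ω ∂μ, EquidistributedOn S.Ω fun i => S.x i ω
  /-- `β*` minimises the oracle risk. -/
  best : ∀ n β, S.oracleRisk n (S.βstar n) ≤ S.oracleRisk n β
  best_ne_zero : ∀ᶠ n in atTop, S.βstar n ≠ 0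
  /-- Lower sparse eigenvalue bound; the limit inferior is taken in the extended reals. -/
  sparse_min : ∀ᵐ ω ∂μ, (κmin : EReal) ≤ liminf (fun n : ℕ =>
    ((sparseMinEig (gram (S.design n ω))
      (S.s n * S.cbar n * S.dbar n * max (Real.log n) (S.cbar n)) : ℝ) : EReal)) atTop
  /-- Upper sparse eigenvalue bound; the limit superior is taken in the extended reals. -/
  sparse_max : ∀ᵐ ω ∂μ, limsup (fun n : ℕ =>
    ((sparseMaxEig (gram (S.design n ω))
      ((S.s n * S.cbar n + n) * S.dbar n) : ℝ) : EReal)) atTop ≤ (κmax : EReal)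
  group_size : (fun n => (S.dbar n : ℝ) ^ 2) =o[atTop] fun n : ℕ => Real.log n
  lam_pos : ∀ n, 0 < S.lam n
  lam_order : S.lam =Θ[atTop] S.lamRate
  /-- `‖y(·) - φ(·)ᵀβ*‖_∞ = O(λ_n)`. -/
  bias : ∃ C : ℝ, ∀ᶠ n in atTop, ∀ t ∈ S.Ω, |S.y t - S.pred n (S.βstar n) t| ≤ C * S.lam n
  estimate : ∀ n ω, IsOverlappingGroupLasso (S.design n ω) (S.response n ω) (S.lam n) (S.J n)
    (S.βhat n ω)

/-- With probability tending to one the oracle risk of the estimate is at most a constant times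
`c̄² s d̄ log p / n`. (The probability of the complement is used since no measurability of the
selected minimiser is assumed: for a non-measurable set, `μ` is the outer measure.) -/
def RiskBound [MeasurableSpace W] (μ : Measure W) : Prop :=
  ∃ C > 0, Tendsto
    (fun n => μ {ω | ¬ S.oracleRisk n (S.βhat n ω) ≤ C * S.riskRate n}) atTop (𝓝 0)

end Experiment

end OGL

namespace OGL

/-! The risk of `b` is controlled by the bias, which is uniformly `O(λ)`, plus the squared
population norm of the prediction with coefficients `b - β*`. That norm is at most a constant times
`‖b - β*‖₂²` (`Assumptions.setIntegral_pred_sq_le`): for a fixed coefficient vector the empirical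
mean squares converge to the uniform average, while the vector, extended by zero, is eventually
`n`-sparse, so the upper eigenvalue bound passes to the limit. It remains to show `‖b - β*‖₂² = O(m
λ²)` with `m = s c̄ d̄`.

The deterministic core is `l2_error_le`. Minimality is tested against replicates that sum exactly to
`β*`: groups missing its support are dropped, and in the at most `s c̄` groups meeting it the excess
`h` is removed, each coefficient from a single group, which costs at most `λ √m ‖h‖₂`. Because the
optimal replicates may be taken as nonnegative shares of `b`, `‖h‖₂ ≤ ‖b - β*‖₂`. If the noise
correlates with every column by at most `nλ/2`, half of the penalty on the dropped groups absorbs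
it, and the error is in `ℓ₁` nearly concentrated on `m` coordinates. Peeling off blocks of `mL`
coordinates turns the sparse eigenvalue bounds into a restricted eigenvalue inequality, and a
quadratic inequality for `‖b - β*‖₂` results.

Probability enters twice. The almost sure eigenvalue bounds give inputs that are good with
probability tending to one. On good inputs the columns have squared norm at most `2κmax n`; by
independence the inputs can be frozen, and a sub-Gaussian union bound over `p` columns fails with
probability at most `2/p`. Without noise this event is empty. -/

/-! ### Euclidean seminorms on coefficient vectors -/

/-- The Euclidean norm on `K → ℝ`, as a seminorm. -/
noncomputable def l2 (K : Type*) [Fintype K] : Seminorm ℝ (K → ℝ) :=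
  (normSeminorm ℝ (EuclideanSpace ℝ K)).comp
    (WithLp.linearEquiv 2 ℝ (K → ℝ)).symm.toLinearMap

theorem l2_apply {K : Type*} [Fintype K] (u : K → ℝ) : l2 K u = √(∑ k, u k ^ 2) := by
  simp [l2, EuclideanSpace.norm_eq]

theorem l2_sq {K : Type*} [Fintype K] (u : K → ℝ) : l2 K u ^ 2 = ∑ k, u k ^ 2 := by
  rw [l2_apply, Real.sq_sqrt (Finset.sum_nonneg fun _ _ => sq_nonneg _)]

theorem l2_le_of_abs_le {K : Type*} [Fintype K] {u w : K → ℝ} (h : ∀ k, |u k| ≤ |w k|) :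
    l2 K u ≤ l2 K w := by
  rw [l2_apply, l2_apply]
  exact Real.sqrt_le_sqrt (Finset.sum_le_sum fun k _ => sq_le_sq.2 (h k))

theorem sum_abs_le_sqrt_card_mul_l2 {K : Type*} [Fintype K] (A : Finset K) (u : K → ℝ) :
    ∑ k ∈ A, |u k| ≤ √(A.card : ℝ) * l2 K u := by
  have h := Real.sum_mul_le_sqrt_mul_sqrt A (fun _ => (1 : ℝ)) (fun k => |u k|)
  simp only [one_mul, one_pow, Finset.sum_const, nsmul_eq_mul, mul_one, sq_abs] at h
  refine h.trans (mul_le_mul_of_nonneg_left ?_ (Real.sqrt_nonneg _))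
  rw [l2_apply]
  exact Real.sqrt_le_sqrt
    (Finset.sum_le_sum_of_subset_of_nonneg (Finset.subset_univ A) fun _ _ _ => sq_nonneg _)

/-- The seminorm `β ↦ ‖Φ β‖₂`. -/
noncomputable def imageSeminorm {K : Type*} [Fintype K] {n : ℕ} (Φ : Matrix (Fin n) K ℝ) :
    Seminorm ℝ (K → ℝ) :=
  (l2 (Fin n)).comp Φ.mulVecLin

theorem imageSeminorm_sq {K : Type*} [Fintype K] {n : ℕ} (Φ : Matrix (Fin n) K ℝ) (u : K → ℝ) :
    imageSeminorm Φ u ^ 2 = ∑ i, ((Φ *ᵥ u) i) ^ 2 := by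
  simp [imageSeminorm, l2_sq]

theorem dotProduct_self_eq_l2_sq {K : Type*} [Fintype K] (u : K → ℝ) : u ⬝ᵥ u = l2 K u ^ 2 := by
  rw [l2_sq]
  simp [dotProduct, sq]

theorem dotProduct_self_pos {K : Type*} [Fintype K] {u : K → ℝ} (h0 : u ≠ 0) : 0 < u ⬝ᵥ u := by
  rw [dotProduct_self_eq_l2_sq, l2_sq]
  obtain ⟨k, hk⟩ := Function.ne_iff.1 h0
  have hk' : u k ≠ 0 := hk
  exact Finset.sum_pos' (fun _ _ => sq_nonneg _) ⟨k, Finset.mem_univ _, by positivity⟩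

theorem dotProduct_gram {K : Type*} [Fintype K] {n : ℕ} (Φ : Matrix (Fin n) K ℝ) (u : K → ℝ) :
    u ⬝ᵥ (gram Φ *ᵥ u) = (1 / (n : ℝ)) * imageSeminorm Φ u ^ 2 := by
  rw [gram, Matrix.smul_mulVec, dotProduct_smul, smul_eq_mul, ← Matrix.mulVec_mulVec,
    Matrix.dotProduct_mulVec, Matrix.vecMul_transpose, imageSeminorm_sq]
  simp [dotProduct, sq]

/-! ### Sparse eigenvalues -/

theorem sparseMinEig_mul_le {K : Type*} [Fintype K] {n : ℕ} (Φ : Matrix (Fin n) K ℝ) {m : ℝ}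
    {u : K → ℝ} (hu : (hammingNorm u : ℝ) ≤ m) :
    sparseMinEig (gram Φ) m * (u ⬝ᵥ u) ≤ u ⬝ᵥ (gram Φ *ᵥ u) := by
  rcases eq_or_ne u 0 with rfl | h0
  · simp
  rw [← le_div_iff₀ (dotProduct_self_pos h0)]
  refine csInf_le ⟨0, ?_⟩ ⟨u, h0, hu, rfl⟩
  rintro r ⟨β, -, -, rfl⟩
  rw [dotProduct_gram, dotProduct_self_eq_l2_sq]
  positivity

/-- The real `sSup` of an unbounded set is `0`, so the Rayleigh quotients must first be bounded; the
sum of the absolute entries of `C` is enough. -/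
theorem le_sparseMaxEig_mul {K : Type*} [Fintype K] (C : Matrix K K ℝ) {m : ℝ}
    {u : K → ℝ} (hu : (hammingNorm u : ℝ) ≤ m) :
    u ⬝ᵥ (C *ᵥ u) ≤ sparseMaxEig C m * (u ⬝ᵥ u) := by
  rcases eq_or_ne u 0 with rfl | h0
  · simp
  rw [← div_le_iff₀ (dotProduct_self_pos h0)]
  refine le_csSup ⟨∑ k, ∑ l, |C k l|, ?_⟩ ⟨u, h0, hu, rfl⟩
  rintro r ⟨β, hβ, -, rfl⟩
  rw [div_le_iff₀ (dotProduct_self_pos hβ), Finset.sum_mul]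
  simp only [dotProduct, Matrix.mulVec]
  refine Finset.sum_le_sum fun k _ => ?_
  rw [Finset.mul_sum, Finset.sum_mul]
  refine Finset.sum_le_sum fun l _ => ?_
  have hle : ∀ k, β k ^ 2 ≤ ∑ i, β i * β i := fun k => by
    rw [sq]
    exact Finset.single_le_sum (f := fun i => β i * β i) (fun i _ => mul_self_nonneg _)
      (Finset.mem_univ k)
  have h1 : |β k * β l| ≤ ∑ i, β i * β i := by
    have := hle k
    have := hle l
    rw [abs_le]
    constructor <;> nlinarith [sq_nonneg (β k - β l), sq_nonneg (β k + β l)]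
  calc β k * (C k l * β l) ≤ |C k l * (β k * β l)| := by
        rw [show β k * (C k l * β l) = C k l * (β k * β l) by ring]; exact le_abs_self _
    _ ≤ _ := by rw [abs_mul]; exact mul_le_mul_of_nonneg_left h1 (abs_nonneg _)

/-- A matrix with fewer rows than columns has a sparse null vector. -/
theorem exists_sparse_null_vector {K : Type*} [Fintype K] {n : ℕ} (Φ : Matrix (Fin n) K ℝ)
    (h : n < Fintype.card K) :
    ∃ u : K → ℝ, u ≠ 0 ∧ hammingNorm u ≤ n + 1 ∧ Φ *ᵥ u = 0 := by
  classical
  obtain ⟨A, -, hA⟩ := Finset.exists_subset_card_eq (s := (Finset.univ : Finset K)) (n := n + 1)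
    (by simpa using h)
  let F : (A → ℝ) →ₗ[ℝ] (Fin n → ℝ) := (Φ.submatrix id (Subtype.val : A → K)).mulVecLin
  have hker : LinearMap.ker F ≠ ⊥ := by
    apply LinearMap.ker_ne_bot_of_finrank_lt
    simp [hA]
  obtain ⟨w, hw, hw0⟩ := (Submodule.ne_bot_iff _).1 hker
  let u : K → ℝ := fun k => if hk : k ∈ A then w ⟨k, hk⟩ else 0
  have huv : ∀ a : A, u a = w a := fun a => by simp [u]
  refine ⟨u, ?_, ?_, ?_⟩
  · intro hu
    apply hw0
    ext a
    rw [← huv, hu]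
    rfl
  · rw [← hA]
    refine Finset.card_le_card fun k hk => ?_
    by_contra hkA
    simp [u, hkA] at hk
  · ext i
    have hi := congrFun (LinearMap.mem_ker.1 hw) i
    simp only [F, Matrix.mulVecLin_apply, Matrix.mulVec, dotProduct, Matrix.submatrix_apply,
      id] at hi
    simp only [Matrix.mulVec, dotProduct]
    rw [← Finset.sum_subset (Finset.subset_univ A) (fun k _ hk => by simp [u, hk]),
      ← Finset.sum_coe_sort]
    simpa [huv] using hi

/-! ### Peeling off the largest coefficients -/

theorem exists_top_finset {K : Type*} (f : K → ℝ) (B : Finset K) (M : ℕ)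
    (hM : M ≤ B.card) :
    ∃ A ⊆ B, A.card = M ∧ ∀ a ∈ A, ∀ b ∈ B, b ∉ A → f b ≤ f a := by
  classical
  induction M with
  | zero => exact ⟨∅, by simp, rfl, by simp⟩
  | succ M ih =>
    obtain ⟨A, hAB, hcard, hA⟩ := ih (by omega)
    have hne : (B \ A).Nonempty := by
      rw [← Finset.card_pos, Finset.card_sdiff_of_subset hAB]
      omega
    obtain ⟨c, hc, hmax⟩ := Finset.exists_max_image (B \ A) f hne
    rw [Finset.mem_sdiff] at hc
    refine ⟨insert c A, Finset.insert_subset hc.1 hAB, ?_, ?_⟩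
    · rw [Finset.card_insert_of_notMem hc.2, hcard]
    · intro a ha b hb hbA
      rw [Finset.mem_insert, not_or] at hbA
      rcases Finset.mem_insert.1 ha with rfl | ha
      · exact hmax b (Finset.mem_sdiff.2 ⟨hb, hbA.2⟩)
      · exact hA a ha b hb hbA.2

/-- Peel off blocks of at most `M` coordinates in decreasing order of size. Each block has `ℓ₂` norm
at most the `ℓ₁` norm of the preceding block over `√M`, so the triangle inequality sums to the `ℓ₁`
norm on `B`. The set `A` is chosen before `N`, so that one split serves several seminorms. -/
theorem exists_sparse_remainder {K : Type*} [Fintype K] {M : ℕ} (hM : 0 < M)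
    (u : K → ℝ) (B : Finset K) :
    ∃ A ⊆ B, A.card ≤ M ∧ ∀ (N : Seminorm ℝ (K → ℝ)) (c : ℝ), 0 ≤ c →
      (∀ w : K → ℝ, hammingNorm w ≤ M → N w ≤ c * l2 K w) →
      N (((B : Set K) \ (A : Set K)).indicator u) ≤ c * ((∑ k ∈ B, |u k|) / √(M : ℝ)) := by
  classical
  induction hb : B.card using Nat.strong_induction_on generalizing B with
  | _ b ih =>
    subst hb
    rcases le_or_gt B.card M with hBM | hBM
    · refine ⟨B, subset_rfl, hBM, fun N c hc _ => ?_⟩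
      simp only [sdiff_self, Set.bot_eq_empty, Set.indicator_empty]
      rw [show (fun _ => (0 : ℝ)) = (0 : K → ℝ) from rfl, map_zero]
      have := Finset.sum_nonneg fun k (_ : k ∈ B) => abs_nonneg (u k)
      positivity
    obtain ⟨A, hAB, hcard, hA⟩ := exists_top_finset (fun k => |u k|) B M hBM.le
    have hlt : (B \ A).card < B.card := by
      rw [Finset.card_sdiff_of_subset hAB]
      omega
    obtain ⟨A', hA'B, hA'card, hA'⟩ := ih _ hlt (B \ A) rfl
    refine ⟨A, hAB, hcard.le, fun N c hc hN => ?_⟩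
    have hrest := hA' N c hc hN
    set w : K → ℝ := (A' : Set K).indicator u with hw
    have hsplit : ((B : Set K) \ (A : Set K)).indicator u =
        w + ((↑(B \ A) : Set K) \ (A' : Set K)).indicator u := by
      ext k
      have hk : k ∈ A' → k ∈ B ∧ k ∉ A := fun h => Finset.mem_sdiff.1 (hA'B h)
      simp only [hw, Pi.add_apply, Set.indicator_apply, Set.mem_sdiff, Finset.mem_coe,
        Finset.mem_sdiff]
      by_cases h : k ∈ A'
      · simp [h, hk h]
      · simp [h]
    have hM' : (0 : ℝ) < M := by exact_mod_cast hM
    set m : ℝ := (∑ k ∈ A, |u k|) / M with hm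
    have hm0 : 0 ≤ m := by
      have := Finset.sum_nonneg fun k (_ : k ∈ A) => abs_nonneg (u k)
      positivity
    -- Entries outside `A` are dominated by each of the `M` entries in `A`, hence by their average
    -- `m`.
    have hle : ∀ k ∈ A', |u k| ≤ m := by
      intro k hk
      have hk' := Finset.mem_sdiff.1 (hA'B hk)
      rw [hm, le_div_iff₀ hM', ← hcard, mul_comm, ← nsmul_eq_mul]
      exact Finset.card_nsmul_le_sum _ _ _ fun a ha => hA a ha k hk'.1 hk'.2
    have hw2 : l2 K w ≤ (∑ k ∈ A, |u k|) / √(M : ℝ) := by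
      have h1 : ∑ k, w k ^ 2 ≤ M * m ^ 2 := by
        rw [← Finset.sum_subset (Finset.subset_univ A')
          (fun k _ hk => by simp [hw, hk])]
        calc ∑ k ∈ A', w k ^ 2 ≤ ∑ k ∈ A', m ^ 2 := by
              refine Finset.sum_le_sum fun k hk => ?_
              have : w k = u k := by simp [hw, hk]
              rw [this, ← sq_abs]
              exact pow_le_pow_left₀ (abs_nonneg _) (hle k hk) 2
          _ ≤ M * m ^ 2 := by
              rw [Finset.sum_const, nsmul_eq_mul]
              have : (A'.card : ℝ) ≤ M := by exact_mod_cast hA'card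
              gcongr
      calc l2 K w ≤ √(M * m ^ 2) := by rw [l2_apply]; exact Real.sqrt_le_sqrt h1
        _ = √(M : ℝ) * m := by rw [Real.sqrt_mul hM'.le, Real.sqrt_sq hm0]
        _ = _ := by
            rw [hm]
            have h2 : √(M : ℝ) * √(M : ℝ) = M := Real.mul_self_sqrt hM'.le
            have h3 : 0 < √(M : ℝ) := Real.sqrt_pos.2 hM'
            field_simp
            rw [sq, h2, mul_comm]
    have hwcard : hammingNorm w ≤ M := by
      refine le_trans (Finset.card_le_card fun k hk => ?_) hA'card
      by_contra hkA
      simp [hw, hkA] at hk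
    calc N (((B : Set K) \ (A : Set K)).indicator u)
        ≤ N w + N (((↑(B \ A) : Set K) \ (A' : Set K)).indicator u) := by
          rw [hsplit]; exact map_add_le_add N _ _
      _ ≤ c * ((∑ k ∈ A, |u k|) / √(M : ℝ)) + c * ((∑ k ∈ B \ A, |u k|) / √(M : ℝ)) :=
          add_le_add ((hN w hwcard).trans (mul_le_mul_of_nonneg_left hw2 hc)) hrest
      _ = c * ((∑ k ∈ B, |u k|) / √(M : ℝ)) := by
          rw [← Finset.sum_sdiff hAB]
          ring

/-- A restricted eigenvalue bound: sparse eigenvalue bounds control `‖u‖₂` by a seminorm of `u`,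
up to the `ℓ₁` norm of `u` off a small set of coordinates. -/
theorem mul_l2_le_of_sparse_bounds {K : Type*} [Fintype K] [DecidableEq K] {m M : ℕ} (hM : 0 < M)
    {a c : ℝ} (ha : 0 ≤ a) (hc : 0 ≤ c) (N : Seminorm ℝ (K → ℝ))
    (hlow : ∀ w : K → ℝ, hammingNorm w ≤ m + M → a * l2 K w ≤ N w)
    (hup : ∀ w : K → ℝ, hammingNorm w ≤ M → N w ≤ c * l2 K w)
    (T : Finset K) (hT : T.card ≤ m) (u : K → ℝ) :
    a * l2 K u ≤ N u + (a + c) * ((∑ k ∈ Tᶜ, |u k|) / √(M : ℝ)) := by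
  obtain ⟨A, hAT, hA, hrem⟩ := exists_sparse_remainder hM u Tᶜ
  set u2 : K → ℝ := ((↑(Tᶜ) : Set K) \ (A : Set K)).indicator u with hu2
  set u1 : K → ℝ := (↑(T ∪ A) : Set K).indicator u with hu1
  have hu : u = u1 + u2 := by
    ext k
    simp only [hu1, hu2, Pi.add_apply, Set.indicator_apply, Set.mem_sdiff, Finset.mem_coe,
      Finset.mem_compl, Finset.mem_union]
    by_cases h1 : k ∈ T <;> by_cases h2 : k ∈ A <;> simp [h1, h2]
  have h1 : hammingNorm u1 ≤ m + M := by
    refine le_trans (Finset.card_le_card (t := T ∪ A) fun k hk => ?_)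
      ((Finset.card_union_le _ _).trans (add_le_add hT hA))
    by_contra hkA
    rw [Finset.mem_filter] at hk
    exact hk.2 (Set.indicator_of_notMem (by simpa using hkA) u)
  have e1 := hlow u1 h1
  have e2 := hrem N c hc hup
  -- The same remainder bound for the Euclidean norm itself, with the same `A`.
  have e3 := hrem (l2 K) 1 zero_le_one fun w _ => by rw [one_mul]
  have e4 : N u1 ≤ N u + N u2 := by
    have : u1 = u - u2 := by rw [hu]; simp
    calc N u1 = N (u - u2) := by rw [← this]
      _ ≤ _ := map_sub_le_add N _ _
  have e5 : l2 K u ≤ l2 K u1 + l2 K u2 := by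
    conv_lhs => rw [hu]
    exact map_add_le_add _ _ _
  have e6 : a * l2 K u ≤ a * l2 K u1 + a * ((∑ k ∈ Tᶜ, |u k|) / √(M : ℝ)) := by
    rw [← mul_add]
    refine mul_le_mul_of_nonneg_left (e5.trans ?_) ha
    linarith
  linarith

/-! ### The group penalty -/

theorem IsReplicated.sqrt_sum_eq_l2 {K : Type*} [Fintype K] {q : ℕ} {J : Fin q → Finset K}
    {v : Fin q → K → ℝ} (hv : IsReplicated J v) (j : Fin q) :
    √(∑ k ∈ J j, v j k ^ 2) = l2 K (v j) := by
  rw [l2_apply]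
  congr 1
  exact Finset.sum_subset (Finset.subset_univ _) fun k _ hk => by rw [hv j k hk]; ring

theorem IsReplicated.objective_eq {K : Type*} [Fintype K] {n q : ℕ} {J : Fin q → Finset K}
    {v : Fin q → K → ℝ} (hv : IsReplicated J v) (Φ : Matrix (Fin n) K ℝ) (Y : Fin n → ℝ)
    (lam : ℝ) {b : K → ℝ} (hb : ∀ k, b k = ∑ j, v j k) :
    objective Φ Y lam J v = 1 / (2 * (n : ℝ)) * ∑ i, (Y i - (Φ *ᵥ b) i) ^ 2
      + lam * ∑ j, √((J j).card : ℝ) * l2 K (v j) := by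
  simp only [objective, hv.sqrt_sum_eq_l2, Matrix.mulVec, dotProduct, hb, mul_comm (Φ _ _)]

theorem IsReplicated.sum_abs_le {K : Type*} [Fintype K] {q : ℕ} {J : Fin q → Finset K}
    {v : Fin q → K → ℝ} (hv : IsReplicated J v) (j : Fin q) :
    ∑ k, |v j k| ≤ √((J j).card : ℝ) * l2 K (v j) := by
  rw [← Finset.sum_subset (Finset.subset_univ (J j)) fun k _ hk => by rw [hv j k hk, abs_zero]]
  exact sum_abs_le_sqrt_card_mul_l2 _ _

/-- The minimising replicates may be taken to split each coefficient into nonnegative shares. -/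
theorem IsOverlappingGroupLasso.exists_shares {K : Type*} [Fintype K] {n q : ℕ}
    {Φ : Matrix (Fin n) K ℝ} {Y : Fin n → ℝ} {lam : ℝ} {J : Fin q → Finset K} {b : K → ℝ}
    (hb : IsOverlappingGroupLasso Φ Y lam J b) (hlam : 0 ≤ lam) :
    ∃ θ : Fin q → K → ℝ, (∀ j k, 0 ≤ θ j k) ∧ (∀ k, ∑ j, θ j k ≤ 1) ∧
      (∀ k, b k = ∑ j, θ j k * b k) ∧ IsReplicated J (fun j k => θ j k * b k) ∧
      ∀ w, IsReplicated J w →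
        objective Φ Y lam J (fun j k => θ j k * b k) ≤ objective Φ Y lam J w := by
  obtain ⟨v, hv, hmin, hsum⟩ := hb
  have hs0 : ∀ k, 0 ≤ ∑ j, |v j k| := fun k => Finset.sum_nonneg fun _ _ => abs_nonneg _
  -- Redistributing `b k` in proportion to `|v j k|` keeps the sums and shrinks every replicate in
  -- absolute value, so the penalty cannot grow. If all replicates of `k` vanish, `0 / 0 = 0` is
  -- harmless since `b k = 0`.
  set θ : Fin q → K → ℝ := fun j k => |v j k| / ∑ i, |v i k| with hθ
  have hble : ∀ k, |b k| ≤ ∑ j, |v j k| := fun k => by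
    rw [hsum]; exact Finset.abs_sum_le_sum_abs _ _
  have hθsum : ∀ k, b k = ∑ j, θ j k * b k := by
    intro k
    rw [← Finset.sum_mul, hθ]
    simp only
    rw [← Finset.sum_div]
    rcases (hs0 k).eq_or_lt with h | h
    · have : b k = 0 := abs_eq_zero.1 (le_antisymm ((hble k).trans h.symm.le) (abs_nonneg _))
      rw [this, mul_zero]
    · rw [div_self h.ne', one_mul]
  have hrep : IsReplicated J (fun j k => θ j k * b k) := fun j k hk => by
    simp [hθ, hv j k hk]
  have habs : ∀ j k, |θ j k * b k| ≤ |v j k| := by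
    intro j k
    rw [abs_mul, abs_of_nonneg (div_nonneg (abs_nonneg _) (hs0 k))]
    rcases (hs0 k).eq_or_lt with h | h
    · simp [← h]
    · rw [div_mul_eq_mul_div, div_le_iff₀ h]
      exact mul_le_mul_of_nonneg_left (hble k) (abs_nonneg _)
  refine ⟨θ, fun j k => div_nonneg (abs_nonneg _) (hs0 k), fun k => ?_, hθsum, hrep,
    fun w hw => le_trans ?_ (hmin w hw)⟩
  · rw [hθ]
    simp only
    rw [← Finset.sum_div]
    exact div_self_le_one _
  · rw [hrep.objective_eq Φ Y lam hθsum, hv.objective_eq Φ Y lam hsum]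
    exact add_le_add_right (mul_le_mul_of_nonneg_left (Finset.sum_le_sum fun j _ =>
      mul_le_mul_of_nonneg_left (l2_le_of_abs_le (habs j)) (Real.sqrt_nonneg _)) hlam) _

theorem card_group_le {K : Type*} {q : ℕ} (J : Fin q → Finset K) (j : Fin q) :
    (J j).card ≤ maxGroupSize J :=
  Finset.le_sup (f := fun j => (J j).card) (Finset.mem_univ j)

open Classical in
-- Each index of the support lies in at most `c̄` groups.
theorem card_groups_meeting_le {K : Type*} [Fintype K] {q : ℕ} (J : Fin q → Finset K)
    (β : K → ℝ) :
    (Finset.univ.filter fun j => ∃ k ∈ J j, β k ≠ 0).card ≤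
      hammingNorm β * maxMultiplicity J := by
  have hsub : (Finset.univ.filter fun j => ∃ k ∈ J j, β k ≠ 0) ⊆
      (Finset.univ.filter fun k => β k ≠ 0).biUnion
        fun k => Finset.univ.filter fun j => k ∈ J j := by
    intro j hj
    obtain ⟨k, hk, hβ⟩ := (Finset.mem_filter.1 hj).2
    simp only [Finset.mem_biUnion, Finset.mem_filter, Finset.mem_univ, true_and]
    exact ⟨k, hβ, hk⟩
  refine (Finset.card_le_card hsub).trans ?_
  have := Finset.card_biUnion_le_card_mul (Finset.univ.filter fun k => β k ≠ 0)
    (fun k => Finset.univ.filter fun j => k ∈ J j) (maxMultiplicity J) fun k _ =>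
      Finset.le_sup (f := fun k : K => (Finset.univ.filter fun j : Fin q => k ∈ J j).card)
        (Finset.mem_univ k)
  unfold hammingNorm
  convert this

/-- The basic inequality of the overlapping group lasso. The estimation error splits into a part
`h` supported on the groups that meet the support of `β` and a part `r` carried by the other
groups, neither of which exceeds the error coefficient by coefficient. -/
theorem IsOverlappingGroupLasso.basic_inequality {K : Type*} [Fintype K] {n q : ℕ}
    {Φ : Matrix (Fin n) K ℝ} {Y : Fin n → ℝ} {lam : ℝ} {J : Fin q → Finset K} {b : K → ℝ}
    (hb : IsOverlappingGroupLasso Φ Y lam J b) (hlam : 0 ≤ lam) (hJ : ∀ k, ∃ j, k ∈ J j)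
    (β : K → ℝ) {m : ℕ} (hm : hammingNorm β * maxMultiplicity J * maxGroupSize J = m) :
    ∃ (T : Finset K) (h r : K → ℝ) (P : ℝ), T.card ≤ m ∧ (∀ k, b k - β k = h k + r k) ∧
      (∀ k ∉ T, h k = 0) ∧ (∀ k, |h k| ≤ |b k - β k|) ∧ ∑ k, |r k| ≤ P ∧
      1 / (2 * (n : ℝ)) * ∑ i, (Y i - (Φ *ᵥ b) i) ^ 2 + lam * P ≤
        1 / (2 * (n : ℝ)) * ∑ i, (Y i - (Φ *ᵥ β) i) ^ 2 + lam * (√(m : ℝ) * l2 K h) := by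
  classical
  obtain ⟨θ, hθ0, hθ1, hθb, hrep, hmin⟩ := hb.exists_shares hlam
  set v : Fin q → K → ℝ := fun j k => θ j k * b k with hv
  set G : Finset (Fin q) := Finset.univ.filter fun j => ∃ k ∈ J j, β k ≠ 0 with hG
  set T : Finset K := G.biUnion J with hT
  set h : K → ℝ := fun k => ∑ j ∈ G, v j k - β k with hh
  set r : K → ℝ := fun k => ∑ j ∈ Gᶜ, v j k with hr
  have hGd : (G.card * maxGroupSize J : ℕ) ≤ m := by
    rw [← hm]
    exact Nat.mul_le_mul_right _ (by convert card_groups_meeting_le J β)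
  have hTcard : T.card ≤ m :=
    (Finset.card_biUnion_le_card_mul _ _ _ fun j _ => card_group_le J j).trans hGd
  have hsupp : ∀ k, β k ≠ 0 → ∀ j, k ∈ J j → j ∈ G := fun k hk j hj =>
    Finset.mem_filter.2 ⟨Finset.mem_univ _, k, hj, hk⟩
  have hoff : ∀ k ∉ T, ∀ j ∈ G, k ∉ J j := fun k hk j hj hkj =>
    hk (Finset.mem_biUnion.2 ⟨j, hj, hkj⟩)
  have hδ : ∀ k, b k - β k = h k + r k := by
    intro k
    have : b k = ∑ j ∈ G, v j k + ∑ j ∈ Gᶜ, v j k := by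
      rw [Finset.sum_add_sum_compl]; exact hθb k
    simp only [hh, hr]
    linarith
  have hhT : ∀ k ∉ T, h k = 0 := by
    intro k hk
    have hβ : β k = 0 := by
      by_contra hβ
      obtain ⟨j, hj⟩ := hJ k
      exact hoff k hk j (hsupp k hβ j hj) hj
    simp only [hh, hβ, sub_zero]
    exact Finset.sum_eq_zero fun j hj => hrep j k (hoff k hk j hj)
  -- Off the support of `β`, `h k` is a fraction of `b k` by the shares; on it, every group
  -- containing `k` lies in `G`, so `r k = 0`.
  have hhδ : ∀ k, |h k| ≤ |b k - β k| := by
    intro k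
    by_cases hβ : β k = 0
    · have h1 : h k = (∑ j ∈ G, θ j k) * b k := by simp [hh, hv, hβ, Finset.sum_mul]
      have h2 : 0 ≤ ∑ j ∈ G, θ j k := Finset.sum_nonneg fun j _ => hθ0 j k
      have h3 : ∑ j ∈ G, θ j k ≤ 1 :=
        (Finset.sum_le_sum_of_subset_of_nonneg (Finset.subset_univ _)
          fun j _ _ => hθ0 j k).trans (hθ1 k)
      rw [h1, hβ, sub_zero, abs_mul, abs_of_nonneg h2]
      exact mul_le_of_le_one_left (abs_nonneg _) h3
    · have h1 : r k = 0 := Finset.sum_eq_zero fun j hj =>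
        hrep j k fun hkj => Finset.mem_compl.1 hj (hsupp k hβ j hkj)
      rw [hδ k, h1, add_zero]
  have hrP : ∑ k, |r k| ≤ ∑ j ∈ Gᶜ, √((J j).card : ℝ) * l2 K (v j) := by
    calc ∑ k, |r k| ≤ ∑ k, ∑ j ∈ Gᶜ, |v j k| :=
          Finset.sum_le_sum fun k _ => Finset.abs_sum_le_sum_abs _ _
      _ = ∑ j ∈ Gᶜ, ∑ k, |v j k| := Finset.sum_comm
      _ ≤ _ := Finset.sum_le_sum fun j _ => hrep.sum_abs_le j
  -- the comparator: remove `h` from the groups in `G`, drop the other groups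
  have hch : ∀ k, ∃ j, k ∈ T → j ∈ G ∧ k ∈ J j := by
    intro k
    by_cases hk : k ∈ T
    · obtain ⟨j, hj, hkj⟩ := Finset.mem_biUnion.1 hk
      exact ⟨j, fun _ => ⟨hj, hkj⟩⟩
    · exact ⟨(hJ k).choose, fun h => absurd h hk⟩
  choose g hg using hch
  -- All of `h k` is charged to one group `g k`, so the `z j` have disjoint supports and their
  -- squared norms add up to at most that of `h`; this avoids a factor `c̄`.
  set z : Fin q → K → ℝ := fun j k => if g k = j ∧ k ∈ T then h k else 0 with hz
  set w : Fin q → K → ℝ := fun j k => if j ∈ G then v j k - z j k else 0 with hw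
  have hwrep : IsReplicated J w := by
    intro j k hk
    have hzk : z j k = 0 := by
      simp only [hz]
      rw [if_neg]
      rintro ⟨rfl, hkT⟩
      exact hk (hg k hkT).2
    simp [hw, hzk, hrep j k hk]
  have hzsum : ∀ k, ∑ j ∈ G, z j k = h k := by
    intro k
    by_cases hk : k ∈ T
    · simp [hz, hk, (hg k hk).1]
    · simp [hz, hk, hhT k hk]
  have hwsum : ∀ k, β k = ∑ j, w j k := by
    intro k
    simp only [hw]
    rw [← Finset.sum_filter, Finset.filter_mem_eq_inter, Finset.univ_inter,
      Finset.sum_sub_distrib, hzsum]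
    simp [hh]
  have hpen : ∑ j, √((J j).card : ℝ) * l2 K (w j) ≤
      ∑ j ∈ G, √((J j).card : ℝ) * l2 K (v j) + ∑ j ∈ G, √((J j).card : ℝ) * l2 K (z j) := by
    have h1 : ∀ j ∈ Gᶜ, √((J j).card : ℝ) * l2 K (w j) = 0 := by
      intro j hj
      have : w j = 0 := by ext k; simp [hw, Finset.mem_compl.1 hj]
      rw [this, map_zero, mul_zero]
    rw [← Finset.sum_add_sum_compl G, Finset.sum_eq_zero h1, add_zero, ← Finset.sum_add_distrib]
    refine Finset.sum_le_sum fun j hj => ?_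
    have : w j = v j - z j := by ext k; simp [hw, hj]
    rw [this, ← mul_add]
    exact mul_le_mul_of_nonneg_left (map_sub_le_add _ _ _) (Real.sqrt_nonneg _)
  -- Cauchy–Schwarz over `G`, where the group sizes sum to at most `m`.
  have hzpen : ∑ j ∈ G, √((J j).card : ℝ) * l2 K (z j) ≤ √(m : ℝ) * l2 K h := by
    refine (Real.sum_mul_le_sqrt_mul_sqrt _ _ _).trans ?_
    have h1 : ∑ j ∈ G, √((J j).card : ℝ) ^ 2 ≤ m := by
      calc ∑ j ∈ G, √((J j).card : ℝ) ^ 2 = ∑ j ∈ G, ((J j).card : ℝ) :=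
            Finset.sum_congr rfl fun j _ => Real.sq_sqrt (Nat.cast_nonneg _)
        _ ≤ ∑ j ∈ G, (maxGroupSize J : ℝ) :=
            Finset.sum_le_sum fun j _ => by exact_mod_cast card_group_le J j
        _ = ((G.card * maxGroupSize J : ℕ) : ℝ) := by simp
        _ ≤ m := by exact_mod_cast hGd
    have h2 : ∑ j ∈ G, l2 K (z j) ^ 2 ≤ ∑ k, h k ^ 2 := by
      simp only [l2_sq]
      rw [Finset.sum_comm]
      refine Finset.sum_le_sum fun k _ => ?_
      by_cases hk : k ∈ T
      · simp [hz, hk, (hg k hk).1, ite_pow]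
      · simp [hz, hk, sq_nonneg]
    rw [l2_apply h]
    gcongr
  refine ⟨T, h, r, _, hTcard, hδ, hhT, hhδ, hrP, ?_⟩
  have hobj := hmin w hwrep
  rw [hrep.objective_eq Φ Y lam hθb, hwrep.objective_eq Φ Y lam hwsum,
    ← Finset.sum_add_sum_compl G (fun j => √((J j).card : ℝ) * l2 K (v j))] at hobj
  have := mul_le_mul_of_nonneg_left (hpen.trans (add_le_add_right hzpen _)) hlam
  linarith

/-! ### The estimation error under sparse eigenvalue bounds -/

/-- The upper bound is available only for `n`-sparse vectors but is needed at sparsity `M`. An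
`M`-sparse vector with more than `n` nonzero entries would force `n + 1 ≤ m`, and then the `(n +
1)`-sparse null vector of `Φ` would contradict the lower bound. -/
theorem imageSeminorm_le_of_sparse_bounds {K : Type*} [Fintype K] {n : ℕ}
    {Φ : Matrix (Fin n) K ℝ} (hn : 0 < n) {κ₁ κ₂ : ℝ} (hκ₁ : 0 < κ₁) {M m : ℕ} (hMm : M ≤ m)
    (hlow : ∀ u : K → ℝ, hammingNorm u ≤ m → κ₁ * (u ⬝ᵥ u) ≤ u ⬝ᵥ (gram Φ *ᵥ u))
    (hup : ∀ u : K → ℝ, hammingNorm u ≤ n → u ⬝ᵥ (gram Φ *ᵥ u) ≤ κ₂ * (u ⬝ᵥ u))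
    (u : K → ℝ) (hu : hammingNorm u ≤ M) :
    imageSeminorm Φ u ≤ √(n * κ₂) * l2 K u := by
  have hun : hammingNorm u ≤ n := by
    rcases le_or_gt (Fintype.card K) n with h | h
    · exact hammingNorm_le_card_fintype.trans h
    · by_contra hlt
      obtain ⟨w, hw0, hw, hΦ⟩ := exists_sparse_null_vector Φ h
      have h1 := hlow w (by omega)
      rw [dotProduct_gram, imageSeminorm_sq, hΦ] at h1
      simp only [Pi.zero_apply, ne_eq, OfNat.ofNat_ne_zero, not_false_eq_true, zero_pow,
        Finset.sum_const_zero, mul_zero] at h1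
      have := mul_pos hκ₁ (dotProduct_self_pos hw0)
      linarith
  have h1 := hup u hun
  have hn' : (0 : ℝ) < n := by exact_mod_cast hn
  rw [dotProduct_gram, dotProduct_self_eq_l2_sq, one_div, inv_mul_le_iff₀ hn', ← mul_assoc] at h1
  have h2 := Real.sqrt_le_sqrt h1
  rw [Real.sqrt_sq (apply_nonneg _ _), Real.sqrt_mul' _ (sq_nonneg _),
    Real.sqrt_sq (apply_nonneg _ _)] at h2
  exact h2

/-- Solving the quadratic inequality for the estimation error. -/
theorem sq_le_of_le_add_of_sq_le {κ D x A lam r : ℝ} (hκ : 0 < κ) (hr : 1 ≤ r) (hD : 0 ≤ D)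
    (h1 : √κ * D / 2 ≤ x + √κ * (A ^ 2 * lam) / 3)
    (h2 : x ^ 2 ≤ 4 * A ^ 2 * lam ^ 2 + 6 * lam * r * D) :
    D ^ 2 ≤ (64 * A ^ 2 / κ + 4 * A ^ 4 + 2304 / κ ^ 2) * r ^ 2 * lam ^ 2 := by
  have hk : √κ ^ 2 = κ := Real.sq_sqrt hκ.le
  have h3 : (√κ * D / 2) ^ 2 ≤ (x + √κ * (A ^ 2 * lam) / 3) ^ 2 :=
    pow_le_pow_left₀ (by positivity) h1 2
  have h4 : κ * D ^ 2 ≤ 8 * x ^ 2 + κ * (A ^ 4 * lam ^ 2) := by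
    have e1 : (√κ * D / 2) ^ 2 = κ * D ^ 2 / 4 := by rw [div_pow, mul_pow, hk]; ring
    have e2 : (√κ * (A ^ 2 * lam) / 3) ^ 2 = κ * (A ^ 4 * lam ^ 2) / 9 := by
      rw [div_pow, mul_pow, hk]; ring
    have e3 : 0 ≤ κ * (A ^ 4 * lam ^ 2) := by positivity
    nlinarith [sq_nonneg (x - √κ * (A ^ 2 * lam) / 3)]
  -- Completing the square: half of `κ D²` absorbs the linear term.
  have h5 : 48 * lam * r * D ≤ κ * D ^ 2 / 2 + 1152 * lam ^ 2 * r ^ 2 / κ := by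
    have : 0 ≤ (κ * D - 48 * (lam * r)) ^ 2 / (2 * κ) := by positivity
    have e : (κ * D - 48 * (lam * r)) ^ 2 / (2 * κ) =
        κ * D ^ 2 / 2 + 1152 * lam ^ 2 * r ^ 2 / κ - 48 * lam * r * D := by
      field_simp
      ring
    linarith
  have h6 : κ * D ^ 2 ≤ 64 * A ^ 2 * lam ^ 2 + 2 * (κ * (A ^ 4 * lam ^ 2)) +
      2304 * lam ^ 2 * r ^ 2 / κ := by
    have : 2304 * lam ^ 2 * r ^ 2 / κ = 2 * (1152 * lam ^ 2 * r ^ 2 / κ) := by ring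
    linarith
  have h7 : κ * D ^ 2 ≤ κ * ((64 * A ^ 2 / κ + 4 * A ^ 4 + 2304 / κ ^ 2) * r ^ 2 * lam ^ 2) := by
    have e : κ * ((64 * A ^ 2 / κ + 4 * A ^ 4 + 2304 / κ ^ 2) * r ^ 2 * lam ^ 2) =
        64 * A ^ 2 * lam ^ 2 * r ^ 2 + 4 * (κ * (A ^ 4 * lam ^ 2)) * r ^ 2 +
          2304 * lam ^ 2 * r ^ 2 / κ := by
      field_simp
    have hr2 : 1 ≤ r ^ 2 := one_le_pow₀ hr
    have e1 : 64 * A ^ 2 * lam ^ 2 ≤ 64 * A ^ 2 * lam ^ 2 * r ^ 2 :=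
      le_mul_of_one_le_right (by positivity) hr2
    have e2 : 4 * (κ * (A ^ 4 * lam ^ 2)) ≤ 4 * (κ * (A ^ 4 * lam ^ 2)) * r ^ 2 :=
      le_mul_of_one_le_right (by positivity) hr2
    have e3 : 0 ≤ κ * (A ^ 4 * lam ^ 2) := by positivity
    linarith
  exact le_of_mul_le_mul_left h7 hκ

/-- The `ℓ₂` error bound for the overlapping group lasso, for responses with a uniformly bounded
bias `B` and an error `ε` that is nearly orthogonal to all columns of the design matrix. -/
theorem IsOverlappingGroupLasso.l2_error_le {K : Type*} [Fintype K] {n q : ℕ}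
    {Φ : Matrix (Fin n) K ℝ} {Y : Fin n → ℝ} {lam : ℝ} {J : Fin q → Finset K} {b : K → ℝ}
    (hb : IsOverlappingGroupLasso Φ Y lam J b) (hn : 0 < n) (hlam : 0 < lam)
    (hJ : ∀ k, ∃ j, k ∈ J j) (β : K → ℝ) {m : ℕ}
    (hm : hammingNorm β * maxMultiplicity J * maxGroupSize J = m) (hm0 : 0 < m)
    {κ₁ κ₂ A : ℝ} (hκ₁ : 0 < κ₁) {L : ℕ} (hL0 : 0 < L)
    (hL : 6 * (√κ₁ + √κ₂) ≤ √κ₁ * √(L : ℝ))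
    (hlow : ∀ u : K → ℝ, hammingNorm u ≤ m * (L + 1) → κ₁ * (u ⬝ᵥ u) ≤ u ⬝ᵥ (gram Φ *ᵥ u))
    (hup : ∀ u : K → ℝ, hammingNorm u ≤ n → u ⬝ᵥ (gram Φ *ᵥ u) ≤ κ₂ * (u ⬝ᵥ u))
    (B ε : Fin n → ℝ) (hY : ∀ i, Y i = (Φ *ᵥ β) i + B i + ε i)
    (hB : ∀ i, |B i| ≤ A * lam) (hε : ∀ k, |∑ i, Φ i k * ε i| ≤ n * (lam / 2)) :
    l2 K (b - β) ^ 2 ≤ (64 * A ^ 2 / κ₁ + 4 * A ^ 4 + 2304 / κ₁ ^ 2) * m * lam ^ 2 := by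
  classical
  obtain ⟨T, h, r, P, hT, hδ, hhT, hhδ, hrP, hbasic⟩ := hb.basic_inequality hlam.le hJ β hm
  have hn' : (0 : ℝ) < n := by exact_mod_cast hn
  have hm1 : (1 : ℝ) ≤ m := by exact_mod_cast hm0
  set δ : K → ℝ := b - β with hδdef
  set D : ℝ := l2 K δ with hD
  set X : ℝ := imageSeminorm Φ δ with hX
  have hD0 : 0 ≤ D := apply_nonneg _ _
  have hX0 : 0 ≤ X := apply_nonneg _ _
  have hH : l2 K h ≤ D := l2_le_of_abs_le hhδ
  have hsqm : (1 : ℝ) ≤ √(m : ℝ) := Real.one_le_sqrt.2 hm1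
  have hδk : ∀ k, δ k = h k + r k := fun k => hδ k
  -- the noise term
  have hnoise : ∑ i, ε i * (Φ *ᵥ δ) i ≤ n * (lam / 2) * (√(m : ℝ) * D + P) := by
    have e1 : ∑ i, ε i * (Φ *ᵥ δ) i = ∑ k, δ k * ∑ i, Φ i k * ε i := by
      simp only [Matrix.mulVec, dotProduct, Finset.mul_sum]
      rw [Finset.sum_comm]
      exact Finset.sum_congr rfl fun k _ => Finset.sum_congr rfl fun i _ => by ring
    have e2 : ∑ k, |δ k| ≤ √(m : ℝ) * D + P := by
      have e3 : ∑ k, |h k| ≤ √(m : ℝ) * D := by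
        rw [← Finset.sum_subset (Finset.subset_univ T) fun k _ hk => by rw [hhT k hk, abs_zero]]
        refine (sum_abs_le_sqrt_card_mul_l2 T h).trans ?_
        have : (T.card : ℝ) ≤ m := by exact_mod_cast hT
        gcongr
      calc ∑ k, |δ k| ≤ ∑ k, (|h k| + |r k|) :=
            Finset.sum_le_sum fun k _ => by rw [hδk]; exact abs_add_le _ _
        _ ≤ _ := by rw [Finset.sum_add_distrib]; exact add_le_add e3 hrP
    calc ∑ i, ε i * (Φ *ᵥ δ) i ≤ ∑ k, |δ k| * (n * (lam / 2)) := by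
          rw [e1]
          refine Finset.sum_le_sum fun k _ => (le_abs_self _).trans ?_
          rw [abs_mul]
          exact mul_le_mul_of_nonneg_left (hε k) (abs_nonneg _)
      _ ≤ _ := by
          rw [← Finset.sum_mul, mul_comm]
          exact mul_le_mul_of_nonneg_left e2 (by positivity)
  -- the bias term
  have hbias : ∑ i, B i * (Φ *ᵥ δ) i ≤ X ^ 2 / 4 + n * (A ^ 2 * lam ^ 2) := by
    calc ∑ i, B i * (Φ *ᵥ δ) i ≤ ∑ i, ((Φ *ᵥ δ) i ^ 2 / 4 + A ^ 2 * lam ^ 2) := by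
          refine Finset.sum_le_sum fun i _ => ?_
          have : B i ^ 2 ≤ (A * lam) ^ 2 := by
            rw [← sq_abs]; exact pow_le_pow_left₀ (abs_nonneg _) (hB i) 2
          nlinarith [sq_nonneg ((Φ *ᵥ δ) i / 2 - B i)]
      _ = _ := by
          rw [Finset.sum_add_distrib, ← Finset.sum_div, ← imageSeminorm_sq]
          simp [hX]
  have hres : ∑ i, (Y i - (Φ *ᵥ b) i) ^ 2 = ∑ i, (Y i - (Φ *ᵥ β) i) ^ 2
      - 2 * (∑ i, B i * (Φ *ᵥ δ) i + ∑ i, ε i * (Φ *ᵥ δ) i) + X ^ 2 := by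
    rw [hX, imageSeminorm_sq, ← Finset.sum_add_distrib, Finset.mul_sum, ← Finset.sum_sub_distrib,
      ← Finset.sum_add_distrib]
    refine Finset.sum_congr rfl fun i _ => ?_
    rw [hδdef, Matrix.mulVec_sub, Pi.sub_apply, hY i]
    ring
  -- Half of the quadratic loss is spent on the bias and half of `λ P` on the noise.
  have hmain : (X ^ 2 / n) / 4 + lam * P / 2 ≤ A ^ 2 * lam ^ 2 + 3 / 2 * lam * √(m : ℝ) * D := by
    rw [hres] at hbasic
    have e1 : lam * (√(m : ℝ) * l2 K h) ≤ lam * (√(m : ℝ) * D) := by gcongr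
    have e2 : 1 / (2 * (n : ℝ)) * (∑ i, (Y i - (Φ *ᵥ β) i) ^ 2
        - 2 * (∑ i, B i * (Φ *ᵥ δ) i + ∑ i, ε i * (Φ *ᵥ δ) i) + X ^ 2) =
        1 / (2 * (n : ℝ)) * ∑ i, (Y i - (Φ *ᵥ β) i) ^ 2 + (X ^ 2 / n) / 2
          - (∑ i, B i * (Φ *ᵥ δ) i + ∑ i, ε i * (Φ *ᵥ δ) i) / n := by
      field_simp
      ring
    have e3 : (∑ i, B i * (Φ *ᵥ δ) i + ∑ i, ε i * (Φ *ᵥ δ) i) / n ≤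
        (X ^ 2 / n) / 4 + A ^ 2 * lam ^ 2 + lam / 2 * (√(m : ℝ) * D + P) := by
      rw [div_le_iff₀ hn']
      have : ((X ^ 2 / n) / 4 + A ^ 2 * lam ^ 2 + lam / 2 * (√(m : ℝ) * D + P)) * n =
        X ^ 2 / 4 + n * (A ^ 2 * lam ^ 2) + n * (lam / 2) * (√(m : ℝ) * D + P) := by
        field_simp
      rw [this]
      linarith
    rw [e2] at hbasic
    linarith
  have hP0 : 0 ≤ P := (Finset.sum_nonneg fun k _ => abs_nonneg (r k)).trans hrP
  -- The cone condition: the part of the error on the other groups is controlled in `ℓ₁` by `√m D`,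
  -- up to the bias.
  have hP : P ≤ 3 * √(m : ℝ) * D + 2 * (A ^ 2 * lam) := by
    have e0 : 0 ≤ X ^ 2 / n := by positivity
    have e1 : lam * P ≤ lam * (3 * √(m : ℝ) * D + 2 * (A ^ 2 * lam)) := by linarith
    exact le_of_mul_le_mul_left e1 hlam
  have hQ : (X / √(n : ℝ)) ^ 2 ≤ 4 * A ^ 2 * lam ^ 2 + 6 * lam * √(m : ℝ) * D := by
    rw [div_pow, Real.sq_sqrt hn'.le]
    have := mul_nonneg hlam.le hP0
    linarith
  -- the restricted eigenvalue bound
  have hML : m * L ≤ m * (L + 1) := Nat.mul_le_mul_left _ (Nat.le_succ _)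
  have hRE := mul_l2_le_of_sparse_bounds (Nat.mul_pos hm0 hL0) (Real.sqrt_nonneg (n * κ₁))
    (Real.sqrt_nonneg (n * κ₂)) (imageSeminorm Φ) (m := m) (fun w hw => ?_)
    (imageSeminorm_le_of_sparse_bounds hn hκ₁ hML hlow hup) T hT δ
  swap
  · have h1 := hlow w (by rw [mul_add_one]; omega)
    rw [dotProduct_gram, dotProduct_self_eq_l2_sq, one_div, le_inv_mul_iff₀ hn', ← mul_assoc] at h1
    have h2 := Real.sqrt_le_sqrt h1
    rwa [Real.sqrt_sq (apply_nonneg _ _), Real.sqrt_mul' _ (sq_nonneg _),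
      Real.sqrt_sq (apply_nonneg _ _)] at h2
  have hL' : (0 : ℝ) < L := by exact_mod_cast hL0
  -- Off `T` the error is `r`, so its `ℓ₁` norm is at most `P`; the `√m` in the bound for `P`
  -- cancels against `√(mL)`, using `1 ≤ √m` for the bias term.
  have htail : (∑ k ∈ Tᶜ, |δ k|) / √((m * L : ℕ) : ℝ) ≤ (3 * D + 2 * (A ^ 2 * lam)) / √(L : ℝ) := by
    have e1 : ∑ k ∈ Tᶜ, |δ k| ≤ P := by
      calc ∑ k ∈ Tᶜ, |δ k| = ∑ k ∈ Tᶜ, |r k| := Finset.sum_congr rfl fun k hk => by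
            rw [hδk, hhT k (Finset.mem_compl.1 hk), zero_add]
        _ ≤ ∑ k, |r k| := Finset.sum_le_sum_of_subset_of_nonneg (Finset.subset_univ _)
            fun _ _ _ => abs_nonneg _
        _ ≤ P := hrP
    have e2 : (0 : ℝ) ≤ 2 * (A ^ 2 * lam) := by positivity
    push_cast
    rw [Real.sqrt_mul (Nat.cast_nonneg _), div_le_div_iff₀ (by positivity) (by positivity)]
    have e3 : P ≤ (3 * D + 2 * (A ^ 2 * lam)) * √(m : ℝ) := by nlinarith
    calc (∑ k ∈ Tᶜ, |δ k|) * √(L : ℝ) ≤ ((3 * D + 2 * (A ^ 2 * lam)) * √(m : ℝ)) * √(L : ℝ) :=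
          mul_le_mul_of_nonneg_right (e1.trans e3) (Real.sqrt_nonneg _)
      _ = _ := by ring
  have hfinal : √κ₁ * D / 2 ≤ X / √(n : ℝ) + √κ₁ * (A ^ 2 * lam) / 3 := by
    have hsn : 0 < √(n : ℝ) := Real.sqrt_pos.2 hn'
    rw [Real.sqrt_mul hn'.le, Real.sqrt_mul hn'.le, ← mul_add] at hRE
    have e1 : √κ₁ * D ≤ X / √(n : ℝ) +
        (√κ₁ + √κ₂) * ((∑ k ∈ Tᶜ, |δ k|) / √((m * L : ℕ) : ℝ)) := by
      refine le_of_mul_le_mul_left ?_ hsn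
      rw [mul_add, mul_div_cancel₀ _ hsn.ne', ← mul_assoc, ← mul_assoc]
      exact hRE
    -- `L` is large enough that the tail costs at most half of `√κ₁ D`.
    have e2 : (√κ₁ + √κ₂) * ((∑ k ∈ Tᶜ, |δ k|) / √((m * L : ℕ) : ℝ)) ≤
        √κ₁ * (3 * D + 2 * (A ^ 2 * lam)) / 6 := by
      have hsL : 0 < √(L : ℝ) := Real.sqrt_pos.2 hL'
      have e3 : 0 ≤ (3 * D + 2 * (A ^ 2 * lam)) / √(L : ℝ) := by positivity
      calc _ ≤ (√κ₁ + √κ₂) * ((3 * D + 2 * (A ^ 2 * lam)) / √(L : ℝ)) :=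
            mul_le_mul_of_nonneg_left htail (by positivity)
        _ ≤ (√κ₁ * √(L : ℝ) / 6) * ((3 * D + 2 * (A ^ 2 * lam)) / √(L : ℝ)) :=
            mul_le_mul_of_nonneg_right (by linarith) e3
        _ = _ := by field_simp
    linarith
  have := sq_le_of_le_add_of_sq_le hκ₁ hsqm hD0 hfinal hQ
  rwa [Real.sq_sqrt (Nat.cast_nonneg _)] at this

/-! ### Sub-Gaussian tails -/

/-- The linear term is kept separate so that it vanishes in expectation for a centred variable,
leaving a bound of second order. -/
theorem exp_le_add_exp_sq (x : ℝ) : Real.exp x ≤ x + Real.exp (x ^ 2) := by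
  have h := Real.add_one_le_exp (x ^ 2)
  rcases le_or_gt |x| 1 with hx | hx
  · have := (abs_le.1 (Real.abs_exp_sub_one_sub_id_le hx)).2
    linarith
  · rcases lt_abs.1 hx with hx | hx
    · have : Real.exp x ≤ Real.exp (x ^ 2) := Real.exp_le_exp.2 (by nlinarith)
      linarith
    · have : Real.exp x ≤ 1 := Real.exp_le_one_iff.2 (by linarith)
      nlinarith

theorem hasDerivAt_exp_mul_sq (c t : ℝ) :
    HasDerivAt (fun t : ℝ => Real.exp (c * t ^ 2)) (2 * c * t * Real.exp (c * t ^ 2)) t := by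
  have := ((hasDerivAt_pow 2 t).const_mul c).exp
  convert this using 1
  push_cast
  ring

/-- Sub-Gaussian tails give a bound for the exponential moment of the square. -/
theorem integrable_exp_sq_of_tail {W : Type*} [MeasurableSpace W] {μ : Measure W}
    [IsProbabilityMeasure μ] {X : W → ℝ} (hX : Measurable X) {K : ℝ} (hK : 0 < K)
    (htail : ∀ t : ℝ, 0 ≤ t → μ.real {ω | t < |X ω|} ≤ Real.exp (1 - t ^ 2 / K)) :
    Integrable (fun ω => Real.exp (1 / (2 * K) * X ω ^ 2)) μ ∧
      ∫ ω, Real.exp (1 / (2 * K) * X ω ^ 2) ∂μ ≤ 1 + Real.exp 1 := by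
  -- Half of the tail rate: multiplying the tail by `exp (c t²)` still leaves the decay `exp (1 - c
  -- t²)`, and the layer-cake integral is then explicit with value `e`.
  set c : ℝ := 1 / (2 * K) with hc
  have hc0 : 0 < c := by positivity
  set g : ℝ → ℝ := fun t => 2 * c * t * Real.exp (c * t ^ 2) with hg
  have hgc : Continuous g := by fun_prop
  have hgint : ∀ a : ℝ, ∫ t in (0 : ℝ)..a, g t = Real.exp (c * a ^ 2) - 1 := by
    intro a
    rw [intervalIntegral.integral_eq_sub_of_hasDerivAt
      (fun t _ => hasDerivAt_exp_mul_sq c t) (hgc.intervalIntegrable _ _)]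
    simp
  have hlayer := lintegral_comp_eq_lintegral_meas_lt_mul μ (f := fun ω => |X ω|) (g := g)
    (ae_of_all _ fun ω => abs_nonneg _) hX.abs.aemeasurable
    (fun t _ => hgc.intervalIntegrable _ _)
    ((ae_restrict_iff' measurableSet_Ioi).2 (ae_of_all _ fun t ht => by
      have : (0 : ℝ) < t := ht
      simp only [hg]
      positivity))
  simp only [hgint, sq_abs] at hlayer
  -- the right-hand side is at most `e`
  set G : ℝ → ℝ := fun t => -Real.exp 1 * Real.exp (-c * t ^ 2) with hG
  set G' : ℝ → ℝ := fun t => Real.exp 1 * (2 * c * t * Real.exp (-c * t ^ 2)) with hG'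
  have hGd : ∀ t, HasDerivAt G (G' t) t := fun t => by
    refine ((hasDerivAt_exp_mul_sq (-c) t).const_mul (-Real.exp 1)).congr_deriv ?_
    simp only [hG']
    ring
  have hG'0 : ∀ t ∈ Set.Ioi (0 : ℝ), 0 ≤ G' t := fun t ht => by
    have : (0 : ℝ) < t := ht
    simp only [hG']
    positivity
  have hGlim : Tendsto G atTop (𝓝 0) := by
    have h1 : Tendsto (fun t : ℝ => c * t ^ 2) atTop atTop :=
      (tendsto_pow_atTop two_ne_zero).const_mul_atTop hc0
    have h2 := (Real.tendsto_exp_neg_atTop_nhds_zero.comp h1).const_mul (-Real.exp 1)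
    simpa [hG, Function.comp_def, neg_mul] using h2
  have hGint := integrableOn_Ioi_deriv_of_nonneg (a := 0)
    (hGd 0).continuousAt.continuousWithinAt (fun t _ => hGd t) hG'0 hGlim
  have hGval := integral_Ioi_of_hasDerivAt_of_nonneg (a := 0)
    (hGd 0).continuousAt.continuousWithinAt (fun t _ => hGd t) hG'0 hGlim
  have hrhs : ∫⁻ t in Set.Ioi (0 : ℝ), μ {ω | t < |X ω|} * ENNReal.ofReal (g t) ≤
      ENNReal.ofReal (Real.exp 1) := by
    calc ∫⁻ t in Set.Ioi (0 : ℝ), μ {ω | t < |X ω|} * ENNReal.ofReal (g t)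
        ≤ ∫⁻ t in Set.Ioi (0 : ℝ), ENNReal.ofReal (G' t) := by
          refine setLIntegral_mono' measurableSet_Ioi fun t ht => ?_
          have h0 : (0 : ℝ) < t := ht
          rw [← ofReal_measureReal, ← ENNReal.ofReal_mul measureReal_nonneg]
          refine ENNReal.ofReal_le_ofReal ?_
          have hg0 : 0 ≤ g t := by simp only [hg]; positivity
          refine (mul_le_mul_of_nonneg_right (htail t h0.le) hg0).trans_eq ?_
          have e : Real.exp (1 - t ^ 2 / K) * Real.exp (c * t ^ 2) =
              Real.exp 1 * Real.exp (-c * t ^ 2) := by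
            rw [← Real.exp_add, ← Real.exp_add, hc]
            congr 1
            field_simp
            ring
          simp only [hg, hG']
          linear_combination (2 * c * t) * e
      _ = ENNReal.ofReal (∫ t in Set.Ioi (0 : ℝ), G' t) := by
          rw [ofReal_integral_eq_lintegral_ofReal hGint
            ((ae_restrict_iff' measurableSet_Ioi).2 (ae_of_all _ hG'0))]
      _ = ENNReal.ofReal (Real.exp 1) := by
          rw [hGval]
          simp [hG]
  have hnn : ∀ ω, 0 ≤ Real.exp (c * X ω ^ 2) - 1 := fun ω =>
    sub_nonneg.2 (Real.one_le_exp (by positivity))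
  have hmeas : Measurable fun ω => Real.exp (c * X ω ^ 2) - 1 := by fun_prop
  have hle : ∫⁻ ω, ENNReal.ofReal (Real.exp (c * X ω ^ 2) - 1) ∂μ ≤
      ENNReal.ofReal (Real.exp 1) := hlayer.trans_le hrhs
  have hint : Integrable (fun ω => Real.exp (c * X ω ^ 2) - 1) μ :=
    ⟨hmeas.aestronglyMeasurable, (hasFiniteIntegral_iff_ofReal (ae_of_all _ hnn)).2
      (hle.trans_lt ENNReal.ofReal_lt_top)⟩
  have hint' : Integrable (fun ω => Real.exp (c * X ω ^ 2)) μ := by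
    simpa [Pi.add_def] using hint.add (integrable_const (1 : ℝ))
  refine ⟨hint', ?_⟩
  have h1 : ∫ ω, (Real.exp (c * X ω ^ 2) - 1) ∂μ ≤ Real.exp 1 := by
    rw [integral_eq_lintegral_of_nonneg_ae (ae_of_all _ hnn) hmeas.aestronglyMeasurable]
    exact ENNReal.toReal_le_of_le_ofReal (Real.exp_pos _).le hle
  rw [integral_sub hint' (integrable_const _)] at h1
  simp only [integral_const, probReal_univ, smul_eq_mul, mul_one] at h1
  linarith

/-- A centred random variable with sub-Gaussian tails has a sub-Gaussian moment generating
function. -/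
theorem hasSubgaussianMGF_of_tail {W : Type*} [MeasurableSpace W] {μ : Measure W}
    [IsProbabilityMeasure μ] {X : W → ℝ} (hX : Measurable X) {K : ℝ} (hK : 0 < K)
    (htail : ∀ t : ℝ, 0 ≤ t → μ.real {ω | t < |X ω|} ≤ Real.exp (1 - t ^ 2 / K))
    (hmean : μ[X] = 0) : HasSubgaussianMGF X (12 * K).toNNReal μ := by
  obtain ⟨hint, hle⟩ := integrable_exp_sq_of_tail hX hK htail
  set c : ℝ := 1 / (2 * K) with hc
  have hc0 : 0 < c := by positivity
  have hdom : ∀ t x : ℝ, Real.exp (t * x) ≤ Real.exp (K * t ^ 2 / 2) * Real.exp (c * x ^ 2) := by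
    intro t x
    rw [← Real.exp_add, Real.exp_le_exp]
    have : 0 ≤ (K * t - x) ^ 2 / (2 * K) := by positivity
    have e : (K * t - x) ^ 2 / (2 * K) = K * t ^ 2 / 2 + c * x ^ 2 - t * x := by
      rw [hc]; field_simp; ring
    linarith
  have hexp : ∀ t : ℝ, Integrable (fun ω => Real.exp (t * X ω)) μ := fun t =>
    (hint.const_mul (Real.exp (K * t ^ 2 / 2))).mono'
      (by fun_prop) (ae_of_all _ fun ω => by
        rw [Real.norm_eq_abs, abs_of_pos (Real.exp_pos _)]; exact hdom t _)
  have hXint : Integrable X μ := by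
    refine ((hexp 1).add (hexp (-1))).mono' hX.aestronglyMeasurable (ae_of_all _ fun ω => ?_)
    rw [Real.norm_eq_abs, abs_le, Pi.add_apply, one_mul, neg_one_mul]
    have h1 := Real.add_one_le_exp (X ω)
    have h2 := Real.add_one_le_exp (-X ω)
    have h3 := Real.exp_pos (X ω)
    have h4 := Real.exp_pos (-X ω)
    constructor <;> linarith
  have hcoe : ((12 * K).toNNReal : ℝ) = 12 * K := Real.coe_toNNReal _ (by positivity)
  have he : Real.exp 1 < 2.7182818286 := Real.exp_one_lt_d9
  refine ⟨hexp, fun t => ?_⟩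
  rw [hcoe, mgf]
  -- For `t² ≤ c`, convexity interpolates `exp (t²x²)` between `1` and `exp (c x²)`, giving `1 +
  -- 2eKt² ≤ 1 + 6Kt²`. For larger `t`, Young's inequality gives `(1 + e) exp (Kt²/2)`, and `1 + e ≤
  -- exp (5Kt²)`. The exponent `6Kt²` of both cases is where `12 K` comes from.
  rcases le_or_gt (t ^ 2) c with ht | ht
  · have hu : t ^ 2 / c ≤ 1 := (div_le_one hc0).2 ht
    have hu0 : 0 ≤ t ^ 2 / c := by positivity
    have hptw : ∀ x : ℝ, Real.exp (t * x) ≤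
        t * x + (1 - t ^ 2 / c) + t ^ 2 / c * Real.exp (c * x ^ 2) := by
      intro x
      have h1 := exp_le_add_exp_sq (t * x)
      have h2 := convexOn_exp.2 (Set.mem_univ (0 : ℝ)) (Set.mem_univ (c * x ^ 2))
        (sub_nonneg.2 hu) hu0 (by ring)
      have e : (1 - t ^ 2 / c) • (0 : ℝ) + (t ^ 2 / c) • (c * x ^ 2) = (t * x) ^ 2 := by
        simp only [smul_eq_mul]
        field_simp
        ring
      rw [e] at h2
      simp only [Real.exp_zero, smul_eq_mul, mul_one] at h2
      linarith
    have hI : ∫ ω, Real.exp (t * X ω) ∂μ ≤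
        ∫ ω, (t * X ω + (1 - t ^ 2 / c) + t ^ 2 / c * Real.exp (c * X ω ^ 2)) ∂μ :=
      integral_mono (hexp t)
        (((hXint.const_mul t).add (integrable_const _)).add (hint.const_mul _))
        fun ω => hptw (X ω)
    have hEq : ∫ ω, (t * X ω + (1 - t ^ 2 / c) + t ^ 2 / c * Real.exp (c * X ω ^ 2)) ∂μ =
        (1 - t ^ 2 / c) + t ^ 2 / c * ∫ ω, Real.exp (c * X ω ^ 2) ∂μ := by
      have i1 : Integrable (fun ω => t * X ω + (1 - t ^ 2 / c)) μ :=
        (hXint.const_mul t).add (integrable_const _)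
      rw [integral_add i1 (hint.const_mul _),
        integral_add (hXint.const_mul t) (integrable_const _), integral_const_mul,
        integral_const_mul, hmean]
      simp
    have h3 : (1 - t ^ 2 / c) + t ^ 2 / c * ∫ ω, Real.exp (c * X ω ^ 2) ∂μ ≤
        12 * K * t ^ 2 / 2 + 1 := by
      have h4 := mul_le_mul_of_nonneg_left hle hu0
      have e : t ^ 2 / c = 2 * K * t ^ 2 := by rw [hc]; field_simp
      rw [e] at h4 ⊢
      have : 0 ≤ K * t ^ 2 := by positivity
      nlinarith
    linarith [Real.add_one_le_exp (12 * K * t ^ 2 / 2)]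
  · have hI : ∫ ω, Real.exp (t * X ω) ∂μ ≤
        ∫ ω, Real.exp (K * t ^ 2 / 2) * Real.exp (c * X ω ^ 2) ∂μ :=
      integral_mono (hexp t) (hint.const_mul _) fun ω => hdom t (X ω)
    rw [integral_const_mul] at hI
    have h1 : 1 < 2 * K * t ^ 2 := by
      rw [hc, div_lt_iff₀ (by positivity)] at ht
      linarith
    have h2 : 1 + Real.exp 1 ≤ Real.exp (5 * K * t ^ 2) := by
      have h5 : Real.exp 2 ≤ Real.exp (5 * K * t ^ 2) := Real.exp_le_exp.2 (by linarith)
      have h6 : Real.exp 2 = Real.exp 1 * Real.exp 1 := by rw [← Real.exp_add]; norm_num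
      have h7 : (2 : ℝ) ≤ Real.exp 1 := by linarith [Real.add_one_le_exp (1 : ℝ)]
      nlinarith
    calc _ ≤ Real.exp (K * t ^ 2 / 2) * Real.exp (5 * K * t ^ 2) :=
          hI.trans (mul_le_mul_of_nonneg_left (hle.trans h2) (Real.exp_pos _).le)
      _ ≤ _ := by
          rw [← Real.exp_add, Real.exp_le_exp]
          have : 0 ≤ K * t ^ 2 := by positivity
          linarith

/-- A weighted sum of independent sub-Gaussian variables deviates by more than `t` with
exponentially small probability. -/
theorem measure_abs_weighted_sum_gt_le {W : Type*} [MeasurableSpace W] {μ : Measure W}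
    [IsProbabilityMeasure μ] {n : ℕ} {X : Fin n → W → ℝ} (hind : iIndepFun X μ) {c : ℝ}
    (hX : ∀ i, HasSubgaussianMGF (X i) c.toNNReal μ) (hc : 0 ≤ c) (a : Fin n → ℝ) {V : ℝ}
    (hV : ∑ i, a i ^ 2 ≤ V) {t : ℝ} (ht : 0 ≤ t) :
    μ.real {ω | t < |∑ i, a i * X i ω|} ≤ 2 * Real.exp (-t ^ 2 / (2 * (c * V))) := by
  have hV0 : 0 ≤ V := (Finset.sum_nonneg fun i _ => sq_nonneg _).trans hV
  have hcV : (((c * V).toNNReal : NNReal) : ℝ) = c * V := Real.coe_toNNReal _ (by positivity)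
  have hmul : ∀ a : Fin n → ℝ, ∑ i, a i ^ 2 ≤ V →
      HasSubgaussianMGF (fun ω => ∑ i, a i * X i ω) (c * V).toNNReal μ := by
    intro a hV
    have h1 : iIndepFun (fun i ω => a i * X i ω) μ :=
      hind.comp (fun i x => a i * x) fun i => measurable_const_mul _
    have h2 : ∀ i ∈ Finset.univ,
        HasSubgaussianMGF (fun ω => a i * X i ω) (a i ^ 2 * c).toNNReal μ := by
      intro i _
      refine ⟨fun s => ?_, fun s => ?_⟩
      · have := (hX i).integrable_exp_mul (s * a i)
        simpa [mul_assoc] using this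
      · have := (hX i).mgf_le (s * a i)
        rw [Real.coe_toNNReal _ hc] at this
        rw [Real.coe_toNNReal _ (by positivity)]
        simp only [mgf] at this ⊢
        calc _ = ∫ ω, Real.exp (s * a i * X i ω) ∂μ := by simp only [mul_assoc]
          _ ≤ _ := this
          _ = _ := by congr 1; ring
    have h3 := HasSubgaussianMGF.sum_of_iIndepFun h1 h2
    refine ⟨h3.integrable_exp_mul, fun s => (h3.mgf_le s).trans ?_⟩
    rw [Real.exp_le_exp, hcV, NNReal.coe_sum]
    have h4 : ∑ i, (((a i ^ 2 * c).toNNReal : NNReal) : ℝ) ≤ c * V := by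
      calc ∑ i, (((a i ^ 2 * c).toNNReal : NNReal) : ℝ) = ∑ i, a i ^ 2 * c :=
            Finset.sum_congr rfl fun i _ => Real.coe_toNNReal _ (by positivity)
        _ ≤ c * V := by
            rw [← Finset.sum_mul, mul_comm]; exact mul_le_mul_of_nonneg_left hV hc
    gcongr
  have h1 := (hmul a hV).measure_ge_le ht
  have h2 := (hmul (fun i => -a i) (by simpa using hV)).measure_ge_le ht
  rw [hcV] at h1 h2
  have hsub : {ω | t < |∑ i, a i * X i ω|} ⊆
      {ω | t ≤ ∑ i, a i * X i ω} ∪ {ω | t ≤ ∑ i, -a i * X i ω} := by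
    intro ω hω
    rcases lt_abs.1 (Set.mem_ofPred_eq ▸ hω) with h | h
    · exact Or.inl h.le
    · right
      simp only [Set.mem_ofPred_eq, neg_mul, Finset.sum_neg_distrib]
      exact h.le
  calc _ ≤ _ := measureReal_mono hsub
    _ ≤ _ := measureReal_union_le _ _
    _ ≤ _ := by linarith

/-- Simultaneous deviation bound for weighted noise sums whose weights are functions of an
independent random input. -/
theorem measure_exists_weighted_sum_gt_le {W E I : Type*} [MeasurableSpace W] [MeasurableSpace E]
    [Fintype I] {μ : Measure W} [IsProbabilityMeasure μ] {x : W → E} {ε : ℕ → W → ℝ}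
    (hx : Measurable x) (hε : ∀ i, Measurable (ε i)) (hind : iIndepFun ε μ)
    (hxε : IndepFun x (fun ω i => ε i ω) μ) {c : ℝ} (hc : 0 ≤ c)
    (hsub : ∀ i, HasSubgaussianMGF (ε i) c.toNNReal μ) {n : ℕ} {a : I → E → Fin n → ℝ}
    (ha : ∀ k i, Measurable fun e => a k e i) {F : Set E} (hF : MeasurableSet F) {V : ℝ}
    (hV : ∀ e ∈ F, ∀ k, ∑ i, a k e i ^ 2 ≤ V) {t : ℝ} (ht : 0 ≤ t) :
    μ {ω | x ω ∈ F ∧ ∃ k, t < |∑ i, a k (x ω) i * ε i ω|} ≤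
      ENNReal.ofReal (Fintype.card I * (2 * Real.exp (-t ^ 2 / (2 * (c * V))))) := by
  have hεm : Measurable fun ω i => ε i ω := measurable_pi_lambda _ hε
  set s : Set (E × (ℕ → ℝ)) := {z | z.1 ∈ F ∧ ∃ k, t < |∑ i, a k z.1 i * z.2 i|} with hs
  have hsm : MeasurableSet s := by
    have e : s = (Prod.fst ⁻¹' F) ∩ ⋃ k, {z : E × (ℕ → ℝ) | t < |∑ i, a k z.1 i * z.2 i|} := by
      ext z; simp [hs]
    rw [e]
    refine (measurable_fst hF).inter (MeasurableSet.iUnion fun k =>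
      measurableSet_lt measurable_const (Measurable.abs ?_))
    refine Finset.measurable_sum _ fun i _ => ?_
    exact ((ha k i).comp measurable_fst).mul ((measurable_pi_apply (i : ℕ)).comp measurable_snd)
  -- Independence makes the joint law a product, so the input can be fixed and the weights treated
  -- as constants; slices outside `F` are empty.
  have hprod := (indepFun_iff_map_prod_eq_prod_map_map hx.aemeasurable hεm.aemeasurable).1 hxε
  have : IsProbabilityMeasure (μ.map x) := Measure.isProbabilityMeasure_map hx.aemeasurable
  have : IsProbabilityMeasure (μ.map fun ω i => ε i ω) :=
    Measure.isProbabilityMeasure_map hεm.aemeasurable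
  have hpre : {ω | x ω ∈ F ∧ ∃ k, t < |∑ i, a k (x ω) i * ε i ω|} =
      (fun ω => (x ω, fun i => ε i ω)) ⁻¹' s := rfl
  rw [hpre, ← Measure.map_apply (hx.prodMk hεm) hsm, hprod, Measure.prod_apply hsm]
  calc _ ≤ ∫⁻ _, ENNReal.ofReal (Fintype.card I * (2 * Real.exp (-t ^ 2 / (2 * (c * V)))))
        ∂(μ.map x) := by
        refine lintegral_mono fun e => ?_
        rw [Measure.map_apply hεm (measurable_prodMk_left hsm)]
        by_cases he : e ∈ F
        · calc _ ≤ μ (⋃ k : I, {ω | t < |∑ i, a k e i * ε i ω|}) := by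
                refine measure_mono fun ω hω => ?_
                obtain ⟨-, k, hk⟩ := hω
                exact Set.mem_iUnion.2 ⟨k, hk⟩
            _ ≤ ∑ k : I, μ {ω | t < |∑ i, a k e i * ε i ω|} := measure_iUnion_fintype_le _ _
            _ ≤ ∑ k : I, ENNReal.ofReal (2 * Real.exp (-t ^ 2 / (2 * (c * V)))) := by
                refine Finset.sum_le_sum fun k _ => ?_
                rw [← ofReal_measureReal]
                exact ENNReal.ofReal_le_ofReal (measure_abs_weighted_sum_gt_le
                  (hind.precomp Fin.val_injective) (fun i => hsub i) hc (a k e) (hV e he k) ht)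
            _ = _ := by
                rw [Finset.sum_const, nsmul_eq_mul, ENNReal.ofReal_mul (Nat.cast_nonneg _),
                  ENNReal.ofReal_natCast, Finset.card_univ]
        · have : (fun ω i => ε i ω) ⁻¹' (Prod.mk e ⁻¹' s) = ∅ := by
            ext ω; simp [hs, he]
          rw [this, measure_empty]
          exact zero_le
    _ = _ := by simp

/-! ### Positive dimensions and extension by zero -/

theorem one_le_maxMultiplicity {K : Type*} [Fintype K] [Nonempty K] {q : ℕ} {J : Fin q → Finset K}
    (hJ : ∀ k, ∃ j, k ∈ J j) : 1 ≤ maxMultiplicity J := by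
  classical
  obtain ⟨k⟩ := ‹Nonempty K›
  obtain ⟨j, hj⟩ := hJ k
  have h1 : 1 ≤ (Finset.univ.filter fun j : Fin q => k ∈ J j).card :=
    Finset.card_pos.2 ⟨j, by simp [hj]⟩
  refine h1.trans ?_
  have := Finset.le_sup (f := fun k : K => (Finset.univ.filter fun j : Fin q => k ∈ J j).card)
    (Finset.mem_univ k)
  unfold maxMultiplicity
  convert this

theorem one_le_maxGroupSize {K : Type*} [Nonempty K] {q : ℕ} {J : Fin q → Finset K}
    (hJ : ∀ k, ∃ j, k ∈ J j) : 1 ≤ maxGroupSize J := by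
  obtain ⟨k⟩ := ‹Nonempty K›
  obtain ⟨j, hj⟩ := hJ k
  exact le_trans (Finset.card_pos.2 ⟨k, hj⟩) (card_group_le J j)

/-- Extension by zero of a coefficient vector. -/
noncomputable def extendZero {ι : Type*} {A : Finset ι} (β : A → ℝ) (B : Finset ι) : B → ℝ :=
  open Classical in fun k => if h : (k : ι) ∈ A then β ⟨k, h⟩ else 0

theorem sum_extendZero {ι : Type*} {A B : Finset ι} (hAB : A ⊆ B) (β : A → ℝ) (g : ι → ℝ → ℝ)
    (hg : ∀ k, g k 0 = 0) : ∑ k : B, g k (extendZero β B k) = ∑ k : A, g k (β k) := by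
  classical
  set γ : ι → ℝ := fun k => if h : k ∈ A then β ⟨k, h⟩ else 0 with hγ
  have h1 : ∑ k : B, g k (extendZero β B k) = ∑ k : B, (fun k => g k (γ k)) k := by
    refine Finset.sum_congr rfl fun k _ => ?_
    simp only [extendZero, hγ]
  have h2 : ∑ k : A, g k (β k) = ∑ k : A, (fun k => g k (γ k)) k := by
    refine Finset.sum_congr rfl fun k _ => ?_
    simp [hγ]
  rw [h1, h2, Finset.sum_coe_sort B (fun k => g k (γ k)),
    Finset.sum_coe_sort A (fun k => g k (γ k))]
  exact (Finset.sum_subset hAB fun k _ hk => by simp [hγ, hk, hg]).symm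

theorem hammingNorm_extendZero_le {ι : Type*} {A : Finset ι} (β : A → ℝ) (B : Finset ι) :
    hammingNorm (extendZero β B) ≤ A.card := by
  refine Finset.card_le_card_of_injOn (fun k : B => (k : ι)) (fun k hk => ?_)
    Subtype.val_injective.injOn
  by_contra hkA
  have hk' := (Finset.mem_filter.1 (Finset.mem_coe.1 hk)).2
  apply hk'
  simp only [extendZero]
  rw [dif_neg]
  exact hkA

namespace Experiment

variable {d : ℕ} {ι W : Type*} {S : Experiment d ι W}

/-! ### Good inputs -/

theorem mulVec_design (n : ℕ) (ω : W) (β : S.P n → ℝ) (i : Fin n) :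
    (S.design n ω *ᵥ β) i = S.pred n β (S.x i ω) := rfl

/-- The design matrix as a measurable function of the inputs. -/
noncomputable def inputDesign (S : Experiment d ι W) (n : ℕ)
    (e : ℕ → EuclideanSpace ℝ (Fin d)) : Fin n → S.P n → ℝ :=
  fun i k => S.Ω.indicator (S.φ k) (e i)

/-- Inputs for which the `m`-sparse eigenvalues are at least `κ₁` and the `n`-sparse eigenvalues
are at most `κ₂`. -/
def goodInputs (S : Experiment d ι W) (n m : ℕ) (κ₁ κ₂ : ℝ) :
    Set (ℕ → EuclideanSpace ℝ (Fin d)) :=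
  {e | ∀ u : S.P n → ℝ,
    (hammingNorm u ≤ m →
      κ₁ * (u ⬝ᵥ u) ≤ u ⬝ᵥ (gram (Matrix.of (S.inputDesign n e)) *ᵥ u)) ∧
    (hammingNorm u ≤ n →
      u ⬝ᵥ (gram (Matrix.of (S.inputDesign n e)) *ᵥ u) ≤ κ₂ * (u ⬝ᵥ u))}

theorem inputDesign_eq_design {n : ℕ} {ω : W} (hω : ∀ i, S.x i ω ∈ S.Ω) :
    Matrix.of (S.inputDesign n fun i => S.x i ω) = S.design n ω := by
  ext i k
  simp [inputDesign, design, hω]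

/-- The upper eigenvalue bound tested on a coordinate vector, which is `n`-sparse because `0 < n`.
-/
theorem sum_inputDesign_sq_le {n m : ℕ} (hn : 0 < n) {κ₁ κ₂ : ℝ}
    {e : ℕ → EuclideanSpace ℝ (Fin d)} (he : e ∈ S.goodInputs n m κ₁ κ₂) (k : S.P n) :
    ∑ i, S.inputDesign n e i k ^ 2 ≤ n * κ₂ := by
  classical
  have h1 : hammingNorm (Pi.single k (1 : ℝ) : S.P n → ℝ) ≤ n := by
    refine le_trans (Finset.card_le_card (t := {k}) fun l hl => ?_)
      ((Finset.card_singleton k).trans_le hn)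
    by_contra hne
    rw [Finset.mem_singleton] at hne
    simp [hne] at hl
  have h2 := (he (Pi.single k 1)).2 h1
  have hn' : (0 : ℝ) < n := by exact_mod_cast hn
  rw [dotProduct_gram, imageSeminorm_sq, one_div, inv_mul_le_iff₀ hn'] at h2
  simpa using h2

variable [MeasurableSpace W] {μ : Measure W} {κmin κmax : ℝ}

/-! ### Basic consequences of the assumptions -/

theorem Assumptions.eventually_dims_pos (H : S.Assumptions μ κmin κmax) :
    ∀ᶠ n in atTop, 1 ≤ S.p n ∧ 1 ≤ S.s n ∧ 1 ≤ S.cbar n ∧ 1 ≤ S.dbar n := by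
  filter_upwards [H.tendsto_p.eventually_ge_atTop 1, H.best_ne_zero] with n hp hs
  have : Nonempty (S.P n) := (Finset.card_pos.1 hp).to_subtype
  exact ⟨hp, hammingNorm_pos_iff.2 hs, one_le_maxMultiplicity (H.groups_cover n),
    one_le_maxGroupSize (H.groups_cover n)⟩

theorem Assumptions.continuousOn_pred (H : S.Assumptions μ κmin κmax) (n : ℕ) (β : S.P n → ℝ) :
    ContinuousOn (S.pred n β) S.Ω :=
  continuousOn_finsetSum _ fun k _ => (H.continuousOn_basis k).mul continuousOn_const

theorem Assumptions.bounded_pred_sq (H : S.Assumptions μ κmin κmax) (n : ℕ) (β : S.P n → ℝ) :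
    ∃ M, ∀ t ∈ S.Ω, |S.pred n β t ^ 2| ≤ M := by
  choose M hM using H.bounded_basis
  refine ⟨(∑ k : S.P n, M k * |β k|) ^ 2, fun t ht => ?_⟩
  rw [abs_pow]
  refine pow_le_pow_left₀ (abs_nonneg _) ((Finset.abs_sum_le_sum_abs _ _).trans ?_) 2
  refine Finset.sum_le_sum fun k _ => ?_
  rw [abs_mul]
  exact mul_le_mul_of_nonneg_right (hM k t ht) (abs_nonneg _)

theorem Assumptions.integrableOn_pred_sq (H : S.Assumptions μ κmin κmax) (n : ℕ)
    (β : S.P n → ℝ) : IntegrableOn (fun t => S.pred n β t ^ 2) S.Ω := by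
  obtain ⟨M, hM⟩ := H.bounded_pred_sq n β
  have : IsFiniteMeasure (volume.restrict S.Ω) :=
    isFiniteMeasure_restrict.2 H.volume_ne_top
  exact Integrable.of_bound
    (((H.continuousOn_pred n β).pow 2).aestronglyMeasurable H.measurableSet_region) M
    ((ae_restrict_iff' H.measurableSet_region).2 (ae_of_all _ hM))

/-- Since `d̄ ≥ 1`, sparsity `n` is within the assumed range; the factor `2` is slack for the limit
superior. -/
theorem Assumptions.eventually_sparseMaxEig_le (H : S.Assumptions μ κmin κmax)
    (hκ : 0 < κmax) : ∀ᵐ ω ∂μ, ∀ᶠ n : ℕ in atTop, ∀ u : S.P n → ℝ, hammingNorm u ≤ n →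
      u ⬝ᵥ (gram (S.design n ω) *ᵥ u) ≤ 2 * κmax * (u ⬝ᵥ u) := by
  filter_upwards [H.sparse_max] with ω hω
  have hlt : (κmax : EReal) < ((2 * κmax : ℝ) : EReal) := by
    rw [EReal.coe_lt_coe_iff]; linarith
  filter_upwards [eventually_lt_of_limsup_lt (hω.trans_lt hlt), H.eventually_dims_pos]
    with n hn hdims u hu
  rw [EReal.coe_lt_coe_iff] at hn
  have hd : (1 : ℝ) ≤ S.dbar n := by exact_mod_cast hdims.2.2.2
  have hu' : (hammingNorm u : ℝ) ≤ (S.s n * S.cbar n + n) * S.dbar n := by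
    have h1 : (hammingNorm u : ℝ) ≤ n := by exact_mod_cast hu
    have h2 : (0 : ℝ) ≤ S.s n * S.cbar n := by positivity
    have h3 : (0 : ℝ) ≤ n := Nat.cast_nonneg n
    nlinarith
  refine (le_sparseMaxEig_mul _ hu').trans (mul_le_mul_of_nonneg_right hn.le ?_)
  rw [dotProduct_self_eq_l2_sq]
  exact sq_nonneg _

/-- The factor `log n` in the assumed sparsity eventually exceeds any constant `L + 1`. -/
theorem Assumptions.eventually_le_sparseMinEig (H : S.Assumptions μ κmin κmax)
    (hκ : 0 < κmin) (L : ℕ) : ∀ᵐ ω ∂μ, ∀ᶠ n : ℕ in atTop, ∀ u : S.P n → ℝ,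
      hammingNorm u ≤ S.s n * S.cbar n * S.dbar n * (L + 1) →
      κmin / 2 * (u ⬝ᵥ u) ≤ u ⬝ᵥ (gram (S.design n ω) *ᵥ u) := by
  filter_upwards [H.sparse_min] with ω hω
  have hlt : ((κmin / 2 : ℝ) : EReal) < (κmin : EReal) := by
    rw [EReal.coe_lt_coe_iff]; linarith
  have hlog : Tendsto (fun n : ℕ => Real.log n) atTop atTop :=
    Real.tendsto_log_atTop.comp tendsto_natCast_atTop_atTop
  filter_upwards [eventually_lt_of_lt_liminf (hlt.trans_le hω),
    hlog.eventually_ge_atTop ((L : ℝ) + 1)] with n hn hL u hu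
  rw [EReal.coe_lt_coe_iff] at hn
  have hu' : (hammingNorm u : ℝ) ≤
      S.s n * S.cbar n * S.dbar n * max (Real.log n) (S.cbar n) := by
    have h1 : (hammingNorm u : ℝ) ≤ S.s n * S.cbar n * S.dbar n * (L + 1) := by exact_mod_cast hu
    exact h1.trans (mul_le_mul_of_nonneg_left (hL.trans (le_max_left _ _)) (by positivity))
  refine le_trans (mul_le_mul_of_nonneg_right hn.le ?_) (sparseMinEig_mul_le _ hu')
  rw [dotProduct_self_eq_l2_sq]
  exact sq_nonneg _

/-- The population version of the upper eigenvalue bound. -/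
theorem Assumptions.setIntegral_pred_sq_le [IsProbabilityMeasure μ]
    (H : S.Assumptions μ κmin κmax) (hκ : 0 < κmax) (N : ℕ) (β : S.P N → ℝ) :
    ∫ t in S.Ω, S.pred N β t ^ 2 ≤ volume.real S.Ω * (2 * κmax * l2 (S.P N) β ^ 2) := by
  -- The conclusion is not random, so a single typical input sequence suffices.
  obtain ⟨ω, hx, hmax⟩ := (H.inputs_uniform.and (H.eventually_sparseMaxEig_le hκ)).exists
  have hlim := hx.2 (fun t => S.pred N β t ^ 2) ((H.continuousOn_pred N β).pow 2)
    (H.bounded_pred_sq N β)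
  have hle : ⨍ t in S.Ω, S.pred N β t ^ 2 ≤ 2 * κmax * l2 (S.P N) β ^ 2 := by
    refine le_of_tendsto hlim ?_
    -- `N` and `β` stay fixed while `n` grows, so `β` needs no sparsity: its support has at most `|P
    -- N| ≤ n` elements eventually.
    filter_upwards [hmax, eventually_ge_atTop N, eventually_ge_atTop (S.P N).card]
      with n hn hN hcard
    have hsub : S.P N ⊆ S.P n := H.basis_mono hN
    have h1 := hn (extendZero β (S.P n)) ((hammingNorm_extendZero_le β _).trans hcard)
    rw [dotProduct_self_eq_l2_sq, l2_sq,
      sum_extendZero hsub β (fun _ b => b ^ 2) (fun _ => by ring), ← l2_sq, dotProduct_gram,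
      imageSeminorm_sq] at h1
    refine le_trans (le_of_eq ?_) h1
    rw [Finset.sum_range]
    congr 1
    refine Finset.sum_congr rfl fun i _ => ?_
    rw [mulVec_design, pred, pred,
      sum_extendZero hsub β (fun k b => S.φ k (S.x i ω) * b) (fun _ => mul_zero _)]
  have hpos : 0 < volume.real S.Ω :=
    ENNReal.toReal_pos H.volume_ne_zero H.volume_ne_top
  rw [setAverage_eq, smul_eq_mul, inv_mul_le_iff₀ hpos] at hle
  exact hle

/-- A bound on the estimation error is a bound on the oracle risk. -/
theorem Assumptions.oracleRisk_le [IsProbabilityMeasure μ] (H : S.Assumptions μ κmin κmax)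
    (hκ : 0 < κmax) {n : ℕ} {A : ℝ}
    (hA : ∀ t ∈ S.Ω, |S.y t - S.pred n (S.βstar n) t| ≤ A * S.lam n) (b : S.P n → ℝ) :
    S.oracleRisk n b ≤ volume.real S.Ω *
      (2 * A ^ 2 * S.lam n ^ 2 + 4 * κmax * l2 (S.P n) (b - S.βstar n) ^ 2) := by
  have hint := H.integrableOn_pred_sq n (b - S.βstar n)
  have hconst : IntegrableOn (fun _ => 2 * A ^ 2 * S.lam n ^ 2) S.Ω :=
    integrableOn_const H.volume_ne_top
  have hpred : ∀ t, S.pred n (b - S.βstar n) t = S.pred n b t - S.pred n (S.βstar n) t := by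
    intro t
    simp [pred, mul_sub, Finset.sum_sub_distrib]
  calc S.oracleRisk n b
      ≤ ∫ t in S.Ω, (2 * A ^ 2 * S.lam n ^ 2 + 2 * S.pred n (b - S.βstar n) t ^ 2) := by
        refine integral_mono_of_nonneg (ae_of_all _ fun t => sq_nonneg _)
          (hconst.add (hint.const_mul 2)) ?_
        refine (ae_restrict_iff' H.measurableSet_region).2 (ae_of_all _ fun t ht => ?_)
        have h1 : (S.y t - S.pred n (S.βstar n) t) ^ 2 ≤ (A * S.lam n) ^ 2 := by
          rw [← sq_abs]; exact pow_le_pow_left₀ (abs_nonneg _) (hA t ht) 2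
        simp only [hpred]
        nlinarith [sq_nonneg ((S.y t - S.pred n (S.βstar n) t) +
          (S.pred n b t - S.pred n (S.βstar n) t))]
    _ = volume.real S.Ω * (2 * A ^ 2 * S.lam n ^ 2) +
          2 * ∫ t in S.Ω, S.pred n (b - S.βstar n) t ^ 2 := by
        rw [integral_add hconst (hint.const_mul 2), setIntegral_const, smul_eq_mul,
          integral_const_mul 2]
    _ ≤ _ := by
        have := H.setIntegral_pred_sq_le hκ n (b - S.βstar n)
        linarith

/-! ### Good inputs are measurable and asymptotically almost sure -/

theorem Assumptions.measurable_indicator_basis (H : S.Assumptions μ κmin κmax) (k : ι) :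
    Measurable (S.Ω.indicator (S.φ k)) := by
  classical
  rw [← Set.piecewise_eq_indicator]
  exact (H.continuousOn_basis k).measurable_piecewise continuousOn_const H.measurableSet_region

theorem Assumptions.measurable_inputDesign (H : S.Assumptions μ κmin κmax) (n : ℕ) :
    Measurable (S.inputDesign n) :=
  measurable_pi_lambda _ fun i => measurable_pi_lambda _ fun k =>
    (H.measurable_indicator_basis k).comp (measurable_pi_apply (i : ℕ))

/-- The conditions range over uncountably many `u`, but each is closed in the design matrix, so
their intersection is closed. -/
theorem Assumptions.measurableSet_goodInputs (H : S.Assumptions μ κmin κmax) (n m : ℕ)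
    (κ₁ κ₂ : ℝ) : MeasurableSet (S.goodInputs n m κ₁ κ₂) := by
  have hcont : ∀ u : S.P n → ℝ, Continuous fun M : Fin n → S.P n → ℝ =>
      u ⬝ᵥ (gram (Matrix.of M) *ᵥ u) := by
    intro u
    simp only [dotProduct_gram, imageSeminorm_sq]
    simp only [Matrix.mulVec, dotProduct, Matrix.of_apply]
    fun_prop
  have hclosed : IsClosed {M : Fin n → S.P n → ℝ | ∀ u : S.P n → ℝ,
      (hammingNorm u ≤ m → κ₁ * (u ⬝ᵥ u) ≤ u ⬝ᵥ (gram (Matrix.of M) *ᵥ u)) ∧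
      (hammingNorm u ≤ n → u ⬝ᵥ (gram (Matrix.of M) *ᵥ u) ≤ κ₂ * (u ⬝ᵥ u))} := by
    simp only [Set.ofPred_forall, Set.ofPred_and]
    exact isClosed_iInter fun u =>
      (isClosed_iInter fun _ => isClosed_le continuous_const (hcont u)).inter
        (isClosed_iInter fun _ => isClosed_le (hcont u) continuous_const)
  exact H.measurable_inputDesign n hclosed.measurableSet

theorem Assumptions.measurable_input_seq (H : S.Assumptions μ κmin κmax) :
    Measurable fun ω i => S.x i ω :=
  measurable_pi_lambda _ H.measurable_inputs

/-- Almost surely the inputs are eventually good, so the indicators of the bad events tend to zero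
almost surely and hence so do the probabilities. -/
theorem Assumptions.tendsto_measure_not_goodInputs [IsProbabilityMeasure μ]
    (H : S.Assumptions μ κmin κmax) (hmin : 0 < κmin) (hmax : 0 < κmax) (L : ℕ) :
    Tendsto (fun n => μ {ω | (fun i => S.x i ω) ∉
      S.goodInputs n (S.s n * S.cbar n * S.dbar n * (L + 1)) (κmin / 2) (2 * κmax)}) atTop
      (𝓝 0) := by
  rw [← measure_empty (μ := μ)]
  refine tendsto_measure_of_ae_tendsto_indicator_of_isFiniteMeasure atTop MeasurableSet.empty
    (fun n => (H.measurable_input_seq (H.measurableSet_goodInputs n _ _ _)).compl) ?_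
  filter_upwards [H.inputs_uniform, H.eventually_sparseMaxEig_le hmax,
    H.eventually_le_sparseMinEig hmin L] with ω hx h1 h2
  filter_upwards [h1, h2] with n h1 h2
  simp only [Set.mem_empty_iff_false, iff_false, not_not, goodInputs, Set.mem_ofPred_eq, inputDesign_eq_design hx.1]
  exact fun u => ⟨h2 u, h1 u⟩

/-! ### From the noise event to the risk bound -/

/-- The risk bound holds as soon as, on good inputs, the noise is nearly orthogonal to the columns
of the design matrix with probability tending to one. -/
theorem Assumptions.riskBound_of_noise [IsProbabilityMeasure μ] (H : S.Assumptions μ κmin κmax)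
    (hmin : 0 < κmin) (hmax : 0 < κmax)
    (hnoise : ∀ m : ℕ → ℕ, Tendsto (fun n => μ {ω |
      (fun i => S.x i ω) ∈ S.goodInputs n (m n) (κmin / 2) (2 * κmax) ∧
      ∃ k, n * (S.lam n / 2) < |∑ i, S.inputDesign n (fun i => S.x i ω) i k * S.ε i ω|})
      atTop (𝓝 0)) : S.RiskBound μ := by
  obtain ⟨A, hA⟩ := H.bias
  obtain ⟨c, hc⟩ := H.lam_order.1.bound
  set κ₁ : ℝ := κmin / 2 with hκ₁
  set κ₂ : ℝ := 2 * κmax with hκ₂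
  have hκ₁0 : 0 < κ₁ := by positivity
  obtain ⟨L, hL⟩ := exists_nat_gt ((6 * (√κ₁ + √κ₂) / √κ₁) ^ 2)
  have hL0 : 0 < L := by
    have : (0 : ℝ) < L := (sq_nonneg _).trans_lt hL
    exact_mod_cast this
  have hLsqrt : 6 * (√κ₁ + √κ₂) ≤ √κ₁ * √(L : ℝ) := by
    have h1 := Real.le_sqrt_of_sq_le hL.le
    rwa [div_le_iff₀' (Real.sqrt_pos.2 hκ₁0)] at h1
  set C₁ : ℝ := 64 * A ^ 2 / κ₁ + 4 * A ^ 4 + 2304 / κ₁ ^ 2 with hC₁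
  have hC₁0 : 0 ≤ C₁ := by positivity
  set C₂ : ℝ := volume.real S.Ω * (2 * A ^ 2 + 4 * κmax * C₁) with hC₂
  have hC₂0 : 0 ≤ C₂ := mul_nonneg measureReal_nonneg (by positivity)
  -- The added `1` only makes the constant strictly positive.
  refine ⟨C₂ * c ^ 2 + 1, by positivity, ?_⟩
  have hxΩ : ∀ᵐ ω ∂μ, ∀ i, S.x i ω ∈ S.Ω := H.inputs_uniform.mono fun ω h => h.1
  have hsum := ((H.tendsto_measure_not_goodInputs hmin hmax L).add
    (hnoise fun n => S.s n * S.cbar n * S.dbar n * (L + 1))).add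
    (tendsto_const_nhds (x := μ {ω | ¬ ∀ i, S.x i ω ∈ S.Ω}))
  rw [ae_iff.1 hxΩ, add_zero, add_zero] at hsum
  refine tendsto_of_tendsto_of_tendsto_of_le_of_le' tendsto_const_nhds hsum
    (Eventually.of_forall fun _ => zero_le) ?_
  filter_upwards [H.eventually_dims_pos, hA, hc, eventually_gt_atTop 0] with n hdims hA hc hn
  refine le_trans (measure_mono fun ω hω => ?_) ((measure_union_le _ _).trans
    (add_le_add (measure_union_le _ _) (ae_iff.1 hxΩ).le))
  by_contra hgood
  simp only [Set.mem_union, Set.mem_ofPred_eq, not_or, not_and, not_not, not_exists,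
    not_lt] at hgood
  obtain ⟨⟨hF, hNF⟩, hx⟩ := hgood
  apply hω
  have hN := hNF hF
  clear hNF
  obtain ⟨hp, hs, hcb, hd⟩ := hdims
  have hdes := inputDesign_eq_design (S := S) (n := n) hx
  simp only [goodInputs, Set.mem_ofPred_eq, hdes] at hF
  set m := S.s n * S.cbar n * S.dbar n with hm
  have hm0 : 0 < m := Nat.mul_pos (Nat.mul_pos hs hcb) hd
  have herr := (H.estimate n ω).l2_error_le hn (H.lam_pos n) (H.groups_cover n) (S.βstar n)
    (m := m) rfl hm0 hκ₁0 hL0 hLsqrt (fun u => (hF u).1) (fun u => (hF u).2)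
    (fun i => S.y (S.x i ω) - S.pred n (S.βstar n) (S.x i ω)) (fun i => S.ε i ω)
    (fun i => by rw [mulVec_design, response]; ring) (fun i => hA _ (hx i)) (fun k => by
      rw [← hdes]; exact hN k)
  have hrisk := H.oracleRisk_le hmax hA (S.βhat n ω)
  have hm1 : (1 : ℝ) ≤ m := by exact_mod_cast hm0
  have hlog : 0 ≤ Real.log (S.p n) / n :=
    div_nonneg (Real.log_natCast_nonneg _) (Nat.cast_nonneg _)
  have hlam : S.lam n ^ 2 ≤ c ^ 2 * (Real.log (S.p n) / n) := by
    rw [Real.norm_eq_abs, Real.norm_eq_abs] at hc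
    have h1 := pow_le_pow_left₀ (abs_nonneg _) hc 2
    rwa [mul_pow, sq_abs, sq_abs, lamRate, Real.sq_sqrt hlog] at h1
  -- The argument yields the rate with a single factor `c̄`; `c̄ ≥ 1` weakens it to `c̄²`.
  have hrate : m * (Real.log (S.p n) / n) ≤ S.riskRate n := by
    have h1 : (m : ℝ) ≤ (S.cbar n : ℝ) ^ 2 * S.s n * S.dbar n := by
      rw [hm]
      push_cast
      have h2 : (1 : ℝ) ≤ S.cbar n := by exact_mod_cast hcb
      have h3 : (S.cbar n : ℝ) ≤ (S.cbar n : ℝ) ^ 2 := by nlinarith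
      calc (S.s n * S.cbar n * S.dbar n : ℝ) = S.cbar n * (S.s n * S.dbar n) := by ring
        _ ≤ (S.cbar n : ℝ) ^ 2 * (S.s n * S.dbar n) :=
            mul_le_mul_of_nonneg_right h3 (by positivity)
        _ = _ := by ring
    calc _ ≤ ((S.cbar n : ℝ) ^ 2 * S.s n * S.dbar n) * (Real.log (S.p n) / n) :=
          mul_le_mul_of_nonneg_right h1 hlog
      _ = S.riskRate n := by rw [riskRate]; ring
  have hrate0 : 0 ≤ S.riskRate n := le_trans (by positivity) hrate
  calc S.oracleRisk n (S.βhat n ω)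
      ≤ volume.real S.Ω * (2 * A ^ 2 * (m * S.lam n ^ 2) +
          4 * κmax * (C₁ * m * S.lam n ^ 2)) := by
        refine hrisk.trans (mul_le_mul_of_nonneg_left ?_ measureReal_nonneg)
        refine add_le_add (mul_le_mul_of_nonneg_left ?_ (by positivity))
          (mul_le_mul_of_nonneg_left herr (by positivity))
        exact le_mul_of_one_le_left (sq_nonneg _) hm1
    _ = C₂ * (m * S.lam n ^ 2) := by rw [hC₂]; ring
    _ ≤ C₂ * (m * (c ^ 2 * (Real.log (S.p n) / n))) := by gcongr
    _ = C₂ * c ^ 2 * (m * (Real.log (S.p n) / n)) := by ring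
    _ ≤ C₂ * c ^ 2 * S.riskRate n := by gcongr
    _ ≤ (C₂ * c ^ 2 + 1) * S.riskRate n := by linarith

theorem Assumptions.riskBound_of_noiseless [IsProbabilityMeasure μ]
    (H : S.Assumptions μ κmin κmax) (hmin : 0 < κmin) (hmax : 0 < κmax)
    (hε : ∀ i ω, S.ε i ω = 0) : S.RiskBound μ := by
  refine H.riskBound_of_noise hmin hmax fun m => ?_
  have h : ∀ n : ℕ, {ω | (fun i => S.x i ω) ∈ S.goodInputs n (m n) (κmin / 2) (2 * κmax) ∧
      ∃ k, n * (S.lam n / 2) < |∑ i, S.inputDesign n (fun i => S.x i ω) i k * S.ε i ω|} = ∅ := by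
    intro n
    refine Set.eq_empty_iff_forall_notMem.2 ?_
    rintro ω ⟨-, k, hk⟩
    simp only [hε, mul_zero, Finset.sum_const_zero, abs_zero] at hk
    have := H.lam_pos n
    have : (0 : ℝ) ≤ n * (S.lam n / 2) := by positivity
    linarith
  simp only [h, measure_empty]
  exact tendsto_const_nhds

theorem Assumptions.riskBound_of_isSubGaussianNoise [IsProbabilityMeasure μ]
    (H : S.Assumptions μ κmin κmax) (hmin : 0 < κmin) (hmax : 0 < κmax) {σ K : ℝ} (hK : 0 < K)
    (hε : IsSubGaussianNoise μ S.x S.ε σ K)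
    (hlam : ∀ᶠ n in atTop, √(384 * K * κmax) * S.lamRate n ≤ S.lam n) : S.RiskBound μ := by
  refine H.riskBound_of_noise hmin hmax fun m => ?_
  have hsub : ∀ i, HasSubgaussianMGF (S.ε i) (12 * K).toNNReal μ := fun i =>
    hasSubgaussianMGF_of_tail (hε.measurable i) hK (hε.tail i) (hε.mean_zero i)
  have hp : Tendsto (fun n => ENNReal.ofReal (2 / S.p n)) atTop (𝓝 0) := by
    rw [← ENNReal.ofReal_zero]
    exact ENNReal.tendsto_ofReal
      ((tendsto_natCast_atTop_atTop.comp H.tendsto_p).const_div_atTop 2)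
  refine tendsto_of_tendsto_of_tendsto_of_le_of_le' tendsto_const_nhds hp
    (Eventually.of_forall fun _ => zero_le) ?_
  filter_upwards [hlam, H.eventually_dims_pos, eventually_gt_atTop 0] with n hlam hdims hn
  have hn' : (0 : ℝ) < n := by exact_mod_cast hn
  have hp1 : (1 : ℝ) ≤ S.p n := by exact_mod_cast hdims.1
  have hp0 : (0 : ℝ) < S.p n := by linarith
  have hlog : 0 ≤ Real.log (S.p n) / n :=
    div_nonneg (Real.log_natCast_nonneg _) (Nat.cast_nonneg _)
  have hlam2 : 384 * K * κmax * (Real.log (S.p n) / n) ≤ S.lam n ^ 2 := by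
    rw [lamRate] at hlam
    have h1 := pow_le_pow_left₀ (mul_nonneg (Real.sqrt_nonneg _) (Real.sqrt_nonneg _)) hlam 2
    rwa [mul_pow, Real.sq_sqrt (by positivity), Real.sq_sqrt hlog] at h1
  have hlam0 := H.lam_pos n
  refine (measure_exists_weighted_sum_gt_le H.measurable_input_seq hε.measurable hε.indep
    hε.indep_inputs (by positivity) hsub
    (a := fun k e i => S.inputDesign n e i k)
    (fun k i => (measurable_pi_apply k).comp ((measurable_pi_apply i).comp
      (H.measurable_inputDesign n)))
    (H.measurableSet_goodInputs n (m n) (κmin / 2) (2 * κmax))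
    (fun e he k => sum_inputDesign_sq_le hn he k) (by positivity)).trans ?_
  refine ENNReal.ofReal_le_ofReal ?_
  -- With threshold `nλ/2`, proxy `12K` and `V = 2κmax n` the exponent is `nλ² / (192 K κmax)`. The
  -- constant `384` makes it at least `2 log p`, so the `p` columns together contribute at most
  -- `2/p`.
  have hexp : -(n * (S.lam n / 2)) ^ 2 / (2 * (12 * K * (n * (2 * κmax)))) ≤
      -(2 * Real.log (S.p n)) := by
    rw [neg_div, neg_le_neg_iff, le_div_iff₀ (by positivity)]
    have h1 := mul_le_mul_of_nonneg_left hlam2 (sq_nonneg (n : ℝ))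
    have h2 : (n : ℝ) ^ 2 * (384 * K * κmax * (Real.log (S.p n) / n)) =
        384 * K * κmax * n * Real.log (S.p n) := by
      field_simp
    rw [h2] at h1
    nlinarith
  have hval : Real.exp (-(2 * Real.log (S.p n))) = ((S.p n : ℝ) ^ 2)⁻¹ := by
    rw [Real.exp_neg, two_mul, Real.exp_add, Real.exp_log hp0, sq]
  have hcard : (Fintype.card (S.P n) : ℝ) = S.p n := by rw [Fintype.card_coe, p]
  rw [hcard]
  calc (S.p n : ℝ) * (2 * Real.exp (-(n * (S.lam n / 2)) ^ 2 / (2 * (12 * K * (n * (2 * κmax))))))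
      ≤ S.p n * (2 * ((S.p n : ℝ) ^ 2)⁻¹) := by
        rw [← hval]
        gcongr
    _ = 2 / S.p n := by field_simp

end Experiment

end OGL

theorem mainTheorem3 :
    -- the deterministic case: responses without noise
    (∀ (d : ℕ) (ι W : Type*) [MeasurableSpace W] (μ : Measure W) [IsProbabilityMeasure μ]
        (S : OGL.Experiment d ι W) (κmin κmax : ℝ), 0 < κmin → κmin ≤ κmax →
        S.Assumptions μ κmin κmax → (∀ i ω, S.ε i ω = 0) → S.RiskBound μ) ∧
    -- the stochastic case: independent identically distributed sub-Gaussian noise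
    (∀ K κmax : ℝ, 0 < K → 0 < κmax → ∃ A > 0,
      ∀ (d : ℕ) (ι W : Type*) [MeasurableSpace W] (μ : Measure W) [IsProbabilityMeasure μ]
        (S : OGL.Experiment d ι W) (κmin σ : ℝ), 0 < κmin → κmin ≤ κmax → 0 < σ →
        S.Assumptions μ κmin κmax → OGL.IsSubGaussianNoise μ S.x S.ε σ K →
        (∀ᶠ n in atTop, A * S.lamRate n ≤ S.lam n) → S.RiskBound μ) := by
  refine ⟨fun d ι W _ μ _ S κmin κmax hmin hle H hε =>
    H.riskBound_of_noiseless hmin (hmin.trans_le hle) hε, fun K κmax hK hmax =>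
    ⟨√(384 * K * κmax), Real.sqrt_pos.2 (by positivity), ?_⟩⟩
  intro d ι W _ μ _ S κmin σ hmin _ _ H hε hlam
  exact H.riskBound_of_isSubGaussianNoise hmin hmax hK hε hlam
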